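/- Circuits consist of CNOT gates and arbitrary single-qubit unitaries (global phases are free), and their cost is the number of CNOTs. An ancilla is *clean* if it starts in $|0\rangle$ and is restored to $|0\rangle$, and *dirty* if it starts in an arbitrary unknown state which is restored. A circuit on $n$ qubits plus ancillas *prepares* an $n$-qubit state $|v\rangle$ if it maps $|0\rangle_n$ to $|v\rangle$ (and restores the ancillas). Let $\operatorname{nnz}(v)$ be the number of nonzero amplitudes of $|v\rangle$ in the computational basis. For $s\le n$, a circuit *pivots $|v\rangle$ up to a diagonal* if it implements a unitary $\Delta\,\mathrm{Piv}$ on the $n$ qubits, where $\Delta$ is a diagonal unitary and $\mathrm{Piv}$ is a permutation of the computational basis states with $\mathrm{Piv}|v\rangle=|i\rangle_{n-s}\otimes|\tilde v\rangle_s$ for some computational basis state $|i\rangle$ of the first $n-s$ qubits and some state $|\tilde v\rangle$ of the last $s$ qubits. For fixed numbers $d$ of dirty and $c$ of clean ancillas, let $\mathcal N_{\mathrm{SP}}(s)$ be the number of CNOTs that suffice to prepare any $s$-qubit state, $\mathcal N_{\mathrm{SSP}}(n,s)$ the number that suffice to prepare any $n$-qubit state with at most $2^s$ nonzero amplitudes,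 and $\mathcal N^\Delta_{\mathrm{Piv}}(n,s)$ the number that suffice to pivot up to a diagonal any $n$-qubit state with at most $2^s$ nonzero amplitudes (each is the supremum over the states in question of the minimum over circuits using these ancillas). Let $|v\rangle$ be an $n$-qubit state and $s=\lceil\log_2\operatorname{nnz}(v)\rceil$. Then: 1. For all $d,c\ge 0$, the state $|v\rangle$ can be prepared with at most $\mathcal N_{\mathrm{SSP}}(n,s)$ CNOTs, and $$\mathcal N_{\mathrm{SSP}}(n,s)\le \mathcal N^\Delta_{\mathrm{Piv}}(n,s)+\mathcal N_{\mathrm{SP}}(s).$$ 2. If $\operatorname{nnz}(v)=1$, then $|v\rangle$ can be prepared without ancillas and without CNOTs. 3. If $\operatorname{nnz}(v)\ge 2$, then $|v\rangle$ can be prepared without ancillas using at most $$(n+16s-9)\operatorname{nnz}(v)+\tfrac{23}{24}2^s$$ CNOTs, and it can be prepared with $\lceil s/2-1\rceil$ clean ancillas using at most $$(n+6s-7)\operatorname{nnz}(v)+\tfrac{23}{24}2^s$$ CNOTs. -/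

import Mathlib

namespace QCirc

/-- Amplitude vectors in the computational basis of a register of qubits labelled by `Q`. -/
abbrev Vec (Q : Type) := (Q → Bool) → ℂ

/-- Quantum states are the unit vectors. -/
def IsState {Q : Type} [Fintype Q] [DecidableEq Q] (v : Vec Q) : Prop :=
  ∑ b : Q → Bool, ‖v b‖ ^ 2 = 1

/-- The number of nonzero amplitudes. -/
noncomputable def nnz {Q : Type} (v : Vec Q) : ℕ := (Function.support v).ncard

/-- The elementary gates: arbitrary single-qubit unitaries and CNOTs. A global phase is itself a
single-qubit gate as soon as there is a qubit; it is listed separately so that the conventions are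
also right for a register of zero qubits. -/
inductive Gate (Q : Type) where
  | phase (z : Circle) : Gate Q
  | single (q : Q) (U : Matrix.unitaryGroup Bool ℂ) : Gate Q
  | cnot (control target : Q) (h : control ≠ target) : Gate Q

/-- Action of a gate on amplitude vectors. -/
noncomputable def Gate.apply {Q : Type} [DecidableEq Q] : Gate Q → Vec Q → Vec Q
  | .phase z, ψ => fun b => (z : ℂ) * ψ b
  | .single q U, ψ => fun b => ∑ x : Bool, (U : Matrix Bool Bool ℂ) (b q) x * ψ (Function.update b q x)
  | .cnot k t _, ψ => fun b => ψ (Function.update b t (xor (b t) (b k)))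

/-- A circuit is a list of gates; the head of the list is applied first. -/
abbrev Circuit (Q : Type) := List (Gate Q)

noncomputable def Circuit.run {Q : Type} [DecidableEq Q] (C : Circuit Q) (ψ : Vec Q) : Vec Q :=
  C.foldl (fun χ g => g.apply χ) ψ

def Gate.cnotCost {Q : Type} : Gate Q → ℕ
  | .cnot _ _ _ => 1
  | _ => 0

/-- The number of CNOT gates of a circuit. -/
def Circuit.cnotCount {Q : Type} (C : Circuit Q) : ℕ := (C.map Gate.cnotCost).sum

/-- `n` system qubits, `d` dirty ancillas and `c` clean ancillas. -/
abbrev Reg (n d c : ℕ) := Fin n ⊕ (Fin d ⊕ Fin c)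

/-- The product vector `ψ ⊗ φ ⊗ |0…0⟩`: system in `ψ`, dirty ancillas in `φ`, clean ancillas in the
all-zero basis state. -/
noncomputable def withAncillas {n d c : ℕ} (ψ : Vec (Fin n)) (φ : Vec (Fin d)) : Vec (Reg n d c) :=
  fun b => ψ (fun i => b (.inl i)) * φ (fun i => b (.inr (.inl i))) *
    (if ∀ i : Fin c, b (.inr (.inr i)) = false then 1 else 0)

/-- `C` implements the operation `U` on the system; all ancillas are restored, whatever the state of
the dirty ones. -/
def Implements {n d c : ℕ} (C : Circuit (Reg n d c)) (U : Vec (Fin n) → Vec (Fin n)) : Prop :=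
  ∀ (ψ : Vec (Fin n)) (φ : Vec (Fin d)),
    C.run (withAncillas ψ φ) = withAncillas (U ψ) φ

/-- The basis state `|0…0⟩`. -/
def zeroVec (n : ℕ) : Vec (Fin n) := fun b => if ∀ i, b i = false then 1 else 0

/-- `C` prepares `v` from `|0…0⟩`; all ancillas are restored, whatever the state of the dirty ones. -/
def Prepares {n d c : ℕ} (C : Circuit (Reg n d c)) (v : Vec (Fin n)) : Prop :=
  ∀ φ : Vec (Fin d), C.run (withAncillas (zeroVec n) φ) = withAncillas v φ

/-- The permutation gate `|b⟩ ↦ |σ b⟩`. -/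
def permGate {Q : Type} (σ : Equiv.Perm (Q → Bool)) (ψ : Vec Q) : Vec Q := fun b => ψ (σ.symm b)

/-- The diagonal gate `|b⟩ ↦ δ b |b⟩`. -/
def diagGate {Q : Type} (δ : (Q → Bool) → Circle) (ψ : Vec Q) : Vec Q := fun b => (δ b : ℂ) * ψ b

/-- The last `s` of `n` qubits. -/
def lastQubits (n s : ℕ) : Finset (Fin n) := Finset.univ.filter (fun j => n - s ≤ j.val)

/-- `w = |i⟩ ⊗ u` for a basis state `|i⟩` of the first `n - s` qubits and a state `u` of the last
`s` qubits. -/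
def IsDisentangled {n : ℕ} (s : ℕ) (w : Vec (Fin n)) : Prop :=
  ∃ (i : {j // j ∉ lastQubits n s} → Bool) (u : Vec {j // j ∈ lastQubits n s}), IsState u ∧
    ∀ b : Fin n → Bool,
      w b = (if (fun j : {j // j ∉ lastQubits n s} => b j.1) = i then 1 else 0) *
        u (fun j => b j.1)

/-- `C` implements `Δ · Piv` for a diagonal gate `Δ` and a permutation gate `Piv` with
`Piv v = |i⟩ ⊗ u`. -/
def PivotsUpToDiag {n d c : ℕ} (s : ℕ) (C : Circuit (Reg n d c)) (v : Vec (Fin n)) : Prop :=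
  ∃ (δ : (Fin n → Bool) → Circle) (σ : Equiv.Perm (Fin n → Bool)),
    IsDisentangled s (permGate σ v) ∧ Implements C (fun ψ => diagGate δ (permGate σ ψ))

/-- Least number of CNOTs of a circuit that prepares `v` with `d` dirty and `c` clean ancillas. -/
noncomputable def prepCost {n : ℕ} (d c : ℕ) (v : Vec (Fin n)) : ℕ∞ :=
  ⨅ (C : Circuit (Reg n d c)) (_ : Prepares C v), (C.cnotCount : ℕ∞)

/-- Least number of CNOTs of a circuit that pivots `v` up to a diagonal gate. -/
noncomputable def pivotCost {n : ℕ} (s d c : ℕ) (v : Vec (Fin n)) : ℕ∞ :=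
  ⨅ (C : Circuit (Reg n d c)) (_ : PivotsUpToDiag s C v), (C.cnotCount : ℕ∞)

/-- CNOTs required to prepare any state of `n` qubits. -/
noncomputable def numSP (n d c : ℕ) : ℕ∞ :=
  ⨆ (v : Vec (Fin n)) (_ : IsState v), prepCost d c v

/-- CNOTs required to prepare any state of `n` qubits with at most `2 ^ s` nonzero amplitudes. -/
noncomputable def numSSP (n s d c : ℕ) : ℕ∞ :=
  ⨆ (v : Vec (Fin n)) (_ : IsState v ∧ nnz v ≤ 2 ^ s), prepCost d c v

/-- CNOTs required to pivot, up to a diagonal gate, any state of `n` qubits with at most `2 ^ s`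
nonzero amplitudes. -/
noncomputable def numPivDiag (n s d c : ℕ) : ℕ∞ :=
  ⨆ (v : Vec (Fin n)) (_ : IsState v ∧ nnz v ≤ 2 ^ s), pivotCost s d c v

end QCirc

/-! Gates are invertible, so a state is prepared by undoing it: a circuit that sends `v` to a
multiple of the zero state is inverted, and one global phase corrects the multiple.

For the reduction to pivoting, a pivoting circuit sends `v` to `Δ (|i⟩ ⊗ u)`. The diagonal only
changes phases, so it is absorbed into the `s`-qubit state to be prepared. Preparing that state,
writing `i` with free bit flips and inverting the pivoting circuit yields `v`
(`exists_prepares_of_pivots`).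

For the explicit counts, fix a set `T` of `s` qubits and call the basis states vanishing off `T` the
block. As long as some support element lies outside the block, some block state is unoccupied. A
fan-out of at most `n - 1` CNOTs followed by one multi-controlled `X` carries the element there
without moving any occupied block state (`exists_pivot_step`). Free flips first bring one support
element to zero, so at most `nnz v - 1` rounds are needed. Only supports matter during the rounds,
so the multi-controlled `X` is needed only up to a diagonal, which makes it cheap: `12 s - 21` CNOTs
without ancillas for `s ≥ 2` (`exists_isFlip_allOn`) and `6 s - 9` with clean ones
(`exists_isFlip_clean`).

The block is then emptied qubit by qubit with uniformly controlled rotations, for `2 * 2 ^ s - 2 - 2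
s` CNOTs (`exists_disentangle`). This may exceed the `23/24 * 2 ^ s` of the claim, but each round
costs three CNOTs less than the coefficient allows, and `2 ^ s < 2 * nnz v` turns this saving into
the missing amount. -/

namespace QCirc

open Function

/-! ### Circuits: composition, linearity, inverses -/

section Basics

variable {Q : Type}

@[simp] theorem cnotCount_nil : Circuit.cnotCount ([] : Circuit Q) = 0 := rfl

theorem cnotCount_cons (g : Gate Q) (C : Circuit Q) :
    Circuit.cnotCount (g :: C) = g.cnotCost + C.cnotCount := by
  simp [Circuit.cnotCount]

theorem cnotCount_append (C D : Circuit Q) :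
    Circuit.cnotCount (C ++ D) = C.cnotCount + D.cnotCount := by
  simp [Circuit.cnotCount]

/-- The inverse gate. -/
noncomputable def Gate.inv : Gate Q → Gate Q
  | .phase z => .phase z⁻¹
  | .single q U => .single q U⁻¹
  | .cnot k t h => .cnot k t h

/-- The inverse circuit. -/
noncomputable def Circuit.inv (C : Circuit Q) : Circuit Q := (C.map Gate.inv).reverse

theorem cnotCount_inv (C : Circuit Q) : C.inv.cnotCount = C.cnotCount := by
  have : ∀ g : Gate Q, g.inv.cnotCost = g.cnotCost := fun g => by
    cases g <;> simp [Gate.inv, Gate.cnotCost]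
  simp [Circuit.cnotCount, Circuit.inv, Function.comp_def, this, List.sum_reverse]

variable [DecidableEq Q]

@[simp] theorem run_nil (ψ : Vec Q) : Circuit.run ([] : Circuit Q) ψ = ψ := rfl

theorem run_cons (g : Gate Q) (C : Circuit Q) (ψ : Vec Q) :
    Circuit.run (g :: C) ψ = C.run (g.apply ψ) := rfl

theorem run_append (C D : Circuit Q) (ψ : Vec Q) :
    Circuit.run (C ++ D) ψ = Circuit.run D (Circuit.run C ψ) := by
  simp [Circuit.run, List.foldl_append]

/-- Apply `M b` to qubit `t`; the single-qubit matrix may depend on the basis state. -/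
def uc (t : Q) (M : (Q → Bool) → Matrix Bool Bool ℂ) (ψ : Vec Q) : Vec Q :=
  fun b => ∑ x : Bool, M b (b t) x * ψ (update b t x)

theorem apply_single (t : Q) (U : Matrix.unitaryGroup Bool ℂ) :
    (Gate.single t U).apply = uc t (fun _ => (U : Matrix Bool Bool ℂ)) := rfl

/-- The matrix of `X ^ c`. -/
def xPow (c : Bool) : Matrix Bool Bool ℂ := Matrix.of fun i j => if xor i c = j then 1 else 0

theorem xPow_apply (c i j : Bool) : xPow c i j = if xor i c = j then 1 else 0 := rfl

theorem xPow_false : xPow false = 1 := by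
  ext i j; cases i <;> cases j <;> simp [xPow]

theorem xPow_mul (c d : Bool) : xPow c * xPow d = xPow (xor c d) := by
  ext i j
  cases i <;> cases j <;> cases c <;> cases d <;> simp [xPow, Matrix.mul_apply]

theorem uc_xPow (t : Q) (p : (Q → Bool) → Bool) (ψ : Vec Q) :
    uc t (fun b => xPow (p b)) ψ = fun b => ψ (update b t (xor (b t) (p b))) := by
  funext b
  simp [uc, xPow_apply]

theorem apply_cnot (k t : Q) (h : k ≠ t) :
    (Gate.cnot k t h).apply = uc t (fun b => xPow (b k)) := by
  funext ψ
  rw [uc_xPow]; rfl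

/-- `f` does not depend on bit `t`. -/
def Indep {α : Type*} (f : (Q → Bool) → α) (t : Q) : Prop := ∀ b x, f (update b t x) = f b

theorem Indep.const {α : Type*} (a : α) (t : Q) : Indep (fun _ : Q → Bool => a) t := fun _ _ => rfl

theorem Indep.eval {k t : Q} (h : k ≠ t) : Indep (fun b : Q → Bool => b k) t :=
  fun b x => update_of_ne h x b

theorem Indep.comp {α β : Type*} {f : (Q → Bool) → α} {t : Q} (hf : Indep f t) (g : α → β) :
    Indep (fun b => g (f b)) t := fun b x => by simp only [hf b x]

theorem Indep.comp₂ {α β γ : Type*} {f : (Q → Bool) → α} {f' : (Q → Bool) → β} {t : Q}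
    (hf : Indep f t) (hf' : Indep f' t) (g : α → β → γ) :
    Indep (fun b => g (f b) (f' b)) t := fun b x => by simp only [hf b x, hf' b x]

theorem uc_uc {t : Q} {M N : (Q → Bool) → Matrix Bool Bool ℂ} (hN : Indep N t) (ψ : Vec Q) :
    uc t M (uc t N ψ) = uc t (fun b => M b * N b) ψ := by
  funext b
  simp only [uc, update_idem, update_self, hN b, Matrix.mul_apply, Fintype.sum_bool]
  ring

theorem uc_one (t : Q) (ψ : Vec Q) : uc t (fun _ => 1) ψ = ψ := by
  funext b
  simp [uc, Matrix.one_apply]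

theorem uc_comm {d q : Q} (h : d ≠ q) {M N : (Q → Bool) → Matrix Bool Bool ℂ}
    (hM : Indep M q) (hN : Indep N d) (ψ : Vec Q) :
    uc d M (uc q N ψ) = uc q N (uc d M ψ) := by
  funext b
  simp only [uc, hM b, hN b, update_of_ne h, update_of_ne h.symm, Fintype.sum_bool,
    update_comm h]
  ring

theorem uc_smul (t : Q) (M : (Q → Bool) → Matrix Bool Bool ℂ) (a : ℂ) (ψ : Vec Q) :
    uc t M (a • ψ) = a • uc t M ψ := by
  funext b
  simp only [uc, Pi.smul_apply, smul_eq_mul, Fintype.sum_bool]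
  ring

theorem apply_smul (g : Gate Q) (a : ℂ) (ψ : Vec Q) : g.apply (a • ψ) = a • g.apply ψ := by
  cases g with
  | phase z => funext b; simp [Gate.apply]; ring
  | single q U => rw [apply_single, uc_smul]
  | cnot k t h => rw [apply_cnot, uc_smul]

theorem run_smul (C : Circuit Q) (a : ℂ) (ψ : Vec Q) : C.run (a • ψ) = a • C.run ψ := by
  induction C generalizing ψ with
  | nil => rfl
  | cons g C ih => rw [run_cons, apply_smul, ih, run_cons]

theorem unitary_mul_inv (U : Matrix.unitaryGroup Bool ℂ) :
    (U : Matrix Bool Bool ℂ) * (U⁻¹ : Matrix.unitaryGroup Bool ℂ) = 1 := by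
  rw [← Matrix.UnitaryGroup.mul_val, mul_inv_cancel, Matrix.UnitaryGroup.one_val]

theorem unitary_inv_mul (U : Matrix.unitaryGroup Bool ℂ) :
    ((U⁻¹ : Matrix.unitaryGroup Bool ℂ) : Matrix Bool Bool ℂ) * U = 1 := by
  rw [← Matrix.UnitaryGroup.mul_val, inv_mul_cancel, Matrix.UnitaryGroup.one_val]

theorem Gate.inv_apply (g : Gate Q) (ψ : Vec Q) : g.inv.apply (g.apply ψ) = ψ := by
  cases g with
  | phase z => funext b; simp [Gate.apply, Gate.inv]
  | single q U =>
    rw [Gate.inv, apply_single, apply_single, uc_uc (Indep.const _ _)]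
    simp only [unitary_inv_mul, uc_one]
  | cnot k t h =>
    rw [Gate.inv, apply_cnot, uc_uc ((Indep.eval h).comp _)]
    simp only [xPow_mul, Bool.xor_self, xPow_false, uc_one]

theorem Circuit.inv_run (C : Circuit Q) (ψ : Vec Q) : C.inv.run (C.run ψ) = ψ := by
  induction C generalizing ψ with
  | nil => rfl
  | cons g C ih =>
    have : Circuit.inv (g :: C) = Circuit.inv C ++ [g.inv] := by simp [Circuit.inv]
    rw [this, run_append, run_cons g C, ih, run_cons, run_nil, Gate.inv_apply]

end Basics

/-! ### Norm preservation -/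

section Norm

variable {Q : Type} [DecidableEq Q]

/-- Flipping bit `t` permutes the basis states, so a sum can be taken over pairs. Norm preservation
of a single-qubit gate thereby becomes a statement about 2×2 unitaries. -/
theorem sum_update_pair [Fintype Q] (t : Q) (F : (Q → Bool) → ℝ) :
    2 * ∑ b, F b = ∑ b, (F (update b t false) + F (update b t true)) := by
  have hinv : Function.Involutive (fun b : Q → Bool => update b t (!b t)) := fun b => by simp
  have h : ∑ b, F (update b t (!b t)) = ∑ b, F b := Equiv.sum_comp hinv.toPerm F
  have h2 : ∀ b : Q → Bool, F (update b t false) + F (update b t true)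
      = F b + F (update b t (!b t)) := fun b => by
    have := update_eq_self t b
    cases hb : b t <;> rw [hb] at this <;> rw [this] <;> simp [add_comm]
  rw [Finset.sum_congr rfl fun b _ => h2 b, Finset.sum_add_distrib, h, two_mul]

theorem norm_sq_mulVec (U : Matrix.unitaryGroup Bool ℂ) (x y : ℂ) :
    ‖U.1 false false * x + U.1 false true * y‖ ^ 2 + ‖U.1 true false * x + U.1 true true * y‖ ^ 2
      = ‖x‖ ^ 2 + ‖y‖ ^ 2 := by
  have h : star U.1 * U.1 = 1 := (Matrix.mem_unitaryGroup_iff').1 U.2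
  have h00 := congrFun (congrFun h false) false
  have h01 := congrFun (congrFun h false) true
  have h10 := congrFun (congrFun h true) false
  have h11 := congrFun (congrFun h true) true
  simp [Matrix.mul_apply, Matrix.star_apply] at h00 h01 h10 h11
  have key : ∀ z : ℂ, ((‖z‖ ^ 2 : ℝ) : ℂ) = z * (starRingEnd ℂ) z := fun z => by
    rw [Complex.mul_conj, Complex.normSq_eq_norm_sq]
  apply Complex.ofReal_injective
  rw [Complex.ofReal_add, Complex.ofReal_add, key, key, key, key]
  simp only [map_add, map_mul]
  -- Both sides are sesquilinear in `(x, y)`; the four entries of `U* U = 1` are weighted by the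
  -- corresponding monomials.
  linear_combination (x * (starRingEnd ℂ) x) * h00 + (y * (starRingEnd ℂ) x) * h01 +
    (x * (starRingEnd ℂ) y) * h10 + (y * (starRingEnd ℂ) y) * h11

theorem apply_norm [Fintype Q] (g : Gate Q) (ψ : Vec Q) :
    ∑ b, ‖g.apply ψ b‖ ^ 2 = ∑ b, ‖ψ b‖ ^ 2 := by
  cases g with
  | phase z => simp [Gate.apply, Circle.norm_coe]
  | single t U =>
    have h := sum_update_pair t fun b => ‖(Gate.single t U).apply ψ b‖ ^ 2
    have h' := sum_update_pair t fun b => ‖ψ b‖ ^ 2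
    have : ∀ b : Q → Bool, ‖(Gate.single t U).apply ψ (update b t false)‖ ^ 2 +
        ‖(Gate.single t U).apply ψ (update b t true)‖ ^ 2 =
        ‖ψ (update b t false)‖ ^ 2 + ‖ψ (update b t true)‖ ^ 2 := fun b => by
      have := norm_sq_mulVec U (ψ (update b t false)) (ψ (update b t true))
      simp only [Gate.apply, Fintype.sum_bool, update_self, update_idem]
      rw [← this]
      congr 3 <;> ring
    rw [Finset.sum_congr rfl fun b _ => this b] at h
    linarith
  | cnot k t hkt =>
    have hinv : Function.Involutive (fun b : Q → Bool => update b t (xor (b t) (b k))) :=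
      fun b => by simp [update_of_ne hkt]
    exact Equiv.sum_comp hinv.toPerm fun b => ‖ψ b‖ ^ 2

theorem run_norm [Fintype Q] (C : Circuit Q) (ψ : Vec Q) :
    ∑ b, ‖C.run ψ b‖ ^ 2 = ∑ b, ‖ψ b‖ ^ 2 := by
  induction C generalizing ψ with
  | nil => rfl
  | cons g C ih => rw [run_cons, ih, apply_norm]

end Norm

/-! ### Relabelling qubits -/

section Relabel

variable {P Q : Type}

/-- Relabel the qubits of a gate. -/
def Gate.relabel (f : P ↪ Q) : Gate P → Gate Q
  | .phase z => .phase z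
  | .single q U => .single (f q) U
  | .cnot k t h => .cnot (f k) (f t) (f.injective.ne h)

/-- Relabel the qubits of a circuit. -/
def Circuit.relabel (f : P ↪ Q) (C : Circuit P) : Circuit Q := C.map (Gate.relabel f)

theorem cnotCount_relabel (f : P ↪ Q) (C : Circuit P) :
    (C.relabel f).cnotCount = C.cnotCount := by
  have : ∀ g : Gate P, (g.relabel f).cnotCost = g.cnotCost := fun g => by
    cases g <;> simp [Gate.relabel, Gate.cnotCost]
  simp [Circuit.cnotCount, Circuit.relabel, Function.comp_def, this]

theorem extend_comp_self (f : P ↪ Q) (b : Q → Bool) : extend f (b ∘ f) b = b := by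
  funext r
  by_cases hr : ∃ p, f p = r
  · obtain ⟨p, rfl⟩ := hr
    rw [f.injective.extend_apply]; rfl
  · rw [extend_apply' _ _ _ hr]

variable [DecidableEq P] [DecidableEq Q]

theorem extend_update (f : P ↪ Q) (x : P → Bool) (b : Q → Bool) (q : P) (y : Bool) :
    extend f (update x q y) b = update (extend f x b) (f q) y := by
  funext r
  by_cases hr : ∃ p, f p = r
  · obtain ⟨p, rfl⟩ := hr
    rw [f.injective.extend_apply]
    by_cases hp : p = q
    · subst hp; simp
    · rw [update_of_ne hp, update_of_ne (f.injective.ne hp), f.injective.extend_apply]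
  · rw [extend_apply' _ _ _ hr, update_of_ne (fun h => hr ⟨q, h.symm⟩), extend_apply' _ _ _ hr]

theorem apply_relabel (f : P ↪ Q) (g : Gate P) (ψ : Vec Q) (b : Q → Bool) (x : P → Bool) :
    (g.relabel f).apply ψ (extend f x b) = g.apply (fun y => ψ (extend f y b)) x := by
  cases g <;> simp [Gate.relabel, Gate.apply, extend_update, f.injective.extend_apply]

/-- A relabelled circuit never touches the bits off the range of `f`. These can be frozen to their
values in `b`, and the circuit acts on each slice separately. -/
theorem run_relabel (f : P ↪ Q) (C : Circuit P) (ψ : Vec Q) (b : Q → Bool) (x : P → Bool) :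
    (C.relabel f).run ψ (extend f x b) = C.run (fun y => ψ (extend f y b)) x := by
  induction C generalizing ψ with
  | nil => rfl
  | cons g C ih =>
    change (Circuit.relabel f C).run ((g.relabel f).apply ψ) _ = Circuit.run C _ x
    rw [ih]
    simp only [apply_relabel]

end Relabel

/-! ### Bit flips -/

section Flips

variable {Q : Type} [DecidableEq Q]

/-- The Pauli matrix `X`. -/
noncomputable def xUnitary : Matrix.unitaryGroup Bool ℂ :=
  ⟨xPow true, by
    rw [Matrix.mem_unitaryGroup_iff]
    ext i j
    cases i <;> cases j <;> simp [xPow, Matrix.mul_apply, Matrix.star_apply]⟩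

theorem exists_flips (J : Finset Q) : ∃ C : Circuit Q, C.cnotCount = 0 ∧
    ∀ ψ, C.run ψ = fun b => ψ (fun j => xor (b j) (decide (j ∈ J))) := by
  induction J using Finset.induction_on with
  | empty => exact ⟨[], rfl, fun ψ => by simp⟩
  | insert k J hk ih =>
    obtain ⟨C, hC, hrun⟩ := ih
    refine ⟨C ++ [.single k xUnitary], by rw [cnotCount_append, hC]; rfl, fun ψ => ?_⟩
    rw [run_append, hrun, run_cons, run_nil, apply_single]
    change uc k (fun b => xPow ((fun _ => true) b)) _ = _
    rw [uc_xPow]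
    funext b
    refine congrArg ψ ?_
    funext j
    by_cases hj : j = k
    · subst hj; simp [hk]
    · simp [hj]

end Flips

/-! ### Uniformly controlled rotations -/

section Rotations

/-- Rotation of the real plane. -/
noncomputable def ryMat (θ : ℝ) : Matrix Bool Bool ℂ :=
  Matrix.of fun i j => if i = j then (Real.cos θ : ℂ) else if i then Real.sin θ else -Real.sin θ

/-- Opposite phases on the two basis states. -/
noncomputable def rzMat (θ : ℝ) : Matrix Bool Bool ℂ :=
  Matrix.of fun i j => if i = j then Complex.exp ((if i then θ else -θ : ℝ) * Complex.I) else 0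

theorem ryMat_mul (a b : ℝ) : ryMat a * ryMat b = ryMat (a + b) := by
  ext i j
  cases i <;> cases j <;>
    simp [ryMat, Matrix.mul_apply, Complex.sin_add, Complex.cos_add] <;> ring

theorem rzMat_mul (a b : ℝ) : rzMat a * rzMat b = rzMat (a + b) := by
  ext i j
  cases i <;> cases j <;>
    simp [rzMat, Matrix.mul_apply, ← Complex.exp_add] <;> ring_nf

theorem ryMat_mem (a : ℝ) : ryMat a ∈ Matrix.unitaryGroup Bool ℂ := by
  have h : star (ryMat a) = ryMat (-a) := by
    ext i j
    cases i <;> cases j <;> simp [ryMat, Matrix.star_apply, -Complex.ofReal_cos,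
      -Complex.ofReal_sin, Complex.conj_ofReal]
  rw [Matrix.mem_unitaryGroup_iff, h, ryMat_mul]
  ext i j
  cases i <;> cases j <;> simp [ryMat]

theorem rzMat_mem (a : ℝ) : rzMat a ∈ Matrix.unitaryGroup Bool ℂ := by
  have h : star (rzMat a) = rzMat (-a) := by
    ext i j
    cases i <;> cases j <;> simp [rzMat, Matrix.star_apply, ← Complex.exp_conj]
  rw [Matrix.mem_unitaryGroup_iff, h, rzMat_mul]
  ext i j
  cases i <;> cases j <;> simp [rzMat]

/-- A one-parameter group of single-qubit unitaries inverted by conjugation with `X`. -/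
structure IsRotation (R : ℝ → Matrix Bool Bool ℂ) : Prop where
  mem : ∀ a, R a ∈ Matrix.unitaryGroup Bool ℂ
  mul : ∀ a b, R a * R b = R (a + b)
  zero : R 0 = 1
  flip : ∀ a, xPow true * R a = R (-a) * xPow true

theorem isRotation_ry : IsRotation ryMat where
  mem := ryMat_mem
  mul := ryMat_mul
  zero := by ext i j; cases i <;> cases j <;> simp [ryMat]
  flip a := by ext i j; cases i <;> cases j <;> simp [ryMat, xPow, Matrix.mul_apply]

theorem isRotation_rz : IsRotation rzMat where
  mem := rzMat_mem
  mul := rzMat_mul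
  zero := by ext i j; cases i <;> cases j <;> simp [rzMat]
  flip a := by ext i j; cases i <;> cases j <;> simp [rzMat, xPow, Matrix.mul_apply]

theorem IsRotation.flip' {R : ℝ → Matrix Bool Bool ℂ} (hR : IsRotation R) (c : Bool) (a : ℝ) :
    xPow c * R a = R (if c then -a else a) * xPow c := by
  cases c
  · simp [xPow_false]
  · simpa using hR.flip a

end Rotations

section UniformlyControlled

variable {Q : Type} [DecidableEq Q]

/-- The circuit `C` maps `uc t N ψ` to `ψ`, so its inverse maps `ψ` back. -/
theorem uc_leftInverse {t : Q} {M N : (Q → Bool) → Matrix Bool Bool ℂ} {C : Circuit Q}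
    (hC : ∀ ψ, C.run ψ = uc t M ψ) (hN : Indep N t) (h : ∀ b, M b * N b = 1) (ψ : Vec Q) :
    C.inv.run ψ = uc t N ψ := by
  have : C.run (uc t N ψ) = ψ := by
    rw [hC, uc_uc hN]
    simp only [h, uc_one]
  rw [← this, Circuit.inv_run, this]

theorem indep_of_dependsOn {α : Type*} {f : (Q → Bool) → α} {S : Set Q} (hf : DependsOn f S)
    {t : Q} (ht : t ∉ S) : Indep f t := fun b x => hf fun i hi => by
  rw [update_of_ne]; rintro rfl; exact ht hi

theorem dependsOn_update {α : Type*} {f : (Q → Bool) → α} {S : Finset Q} {k : Q}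
    (hf : DependsOn f (insert k S : Finset Q)) (x : Bool) :
    DependsOn (fun b => f (update b k x)) (S : Set Q) := fun b b' h => hf fun i hi => by
  by_cases hik : i = k
  · subst hik; simp
  · rw [update_of_ne hik, update_of_ne hik]
    exact h i (by simpa [hik] using hi)

/-- Uniformly controlled rotations up to a final bit flip. -/
theorem exists_uniformlyControlled (t : Q) (S : Finset Q) (ht : t ∉ S) :
    ∃ β : (Q → Bool) → Bool, DependsOn β (S : Set Q) ∧
      ∀ R : ℝ → Matrix Bool Bool ℂ, IsRotation R →
      ∀ θ : (Q → Bool) → ℝ, DependsOn θ (S : Set Q) →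
        ∃ C : Circuit Q, C.cnotCount + 1 = 2 ^ S.card ∧
          ∀ ψ, C.run ψ = uc t (fun b => R (θ b) * xPow (β b)) ψ := by
  induction S using Finset.induction_on with
  | empty =>
    refine ⟨fun _ => false, fun _ _ _ => rfl, fun R hR θ hθ => ?_⟩
    refine ⟨[.single t ⟨R (θ fun _ => false), hR.mem _⟩], by
      simp [cnotCount_cons, Gate.cnotCost], fun ψ => ?_⟩
    rw [run_cons, run_nil, apply_single]
    have : ∀ b, θ b = θ fun _ => false := fun b => hθ (by simp)
    simp only [this, xPow_false, mul_one]
  | insert k S hk ih =>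
    have htk : k ≠ t := fun h => ht (by simp [h])
    have htS : t ∉ S := fun h => ht (by simp [h])
    obtain ⟨β, hβ, ih⟩ := ih htS
    -- The leftover flip depends neither on `R` nor on the angles. Two uniformly controlled
    -- rotations about different axes can therefore cancel their leftovers against each other.
    refine ⟨fun b => b k, fun b b' h => h k (by simp), fun R hR θ hθ => ?_⟩
    have h0 := dependsOn_update hθ false
    have h1 := dependsOn_update hθ true
    -- Half-sum and half-difference of the two angles: conjugation by the CNOT from `k` changes the
    -- sign of the second, so their combination is the angle selected by `b k`.
    obtain ⟨A, hA, hArun⟩ := ih R hR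
      (fun b => (θ (update b k false) + θ (update b k true)) / 2)
      (fun b b' h => by simp only [h0 h, h1 h])
    -- This circuit is used inverted, hence the sign of its angle. Inversion puts its leftover flip
    -- next to that of `A`, where the two cancel across the CNOT.
    obtain ⟨B, hB, hBrun⟩ := ih R hR
      (fun b => -((θ (update b k false) - θ (update b k true)) / 2))
      (fun b b' h => by simp only [h0 h, h1 h])
    refine ⟨B.inv ++ (Gate.cnot k t htk :: A), ?_, fun ψ => ?_⟩
    · rw [cnotCount_append, cnotCount_cons, cnotCount_inv, Finset.card_insert_of_notMem hk,
        pow_succ, ← hA]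
      simp only [Gate.cnotCost]
      omega
    · have iβ := indep_of_dependsOn hβ (by simpa using htS)
      have i0 := indep_of_dependsOn h0 (by simpa using htS)
      have i1 := indep_of_dependsOn h1 (by simpa using htS)
      have iB : Indep (fun b => xPow (β b) * R ((θ (update b k false) - θ (update b k true)) / 2)) t :=
        fun b x => by simp only [iβ b x, i0 b x, i1 b x]
      have hx : ∀ c, xPow c * xPow c = 1 := fun c => by
        rw [xPow_mul, Bool.xor_self, xPow_false]
      rw [run_append, run_cons, apply_cnot, hArun, uc_leftInverse hBrun iB, uc_uc iB, uc_uc]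
      · refine congrArg (fun M => uc t M ψ) (funext fun b => ?_)
        have hb := update_eq_self k b
        rw [mul_assoc, ← mul_assoc (xPow (b k)), ← mul_assoc (xPow (β b)), xPow_mul, Bool.xor_comm,
          ← xPow_mul, ← mul_assoc (xPow (β b)), hx, one_mul, hR.flip',
          ← mul_assoc, hR.mul]
        congr 2
        cases hbk : b k <;> rw [hbk] at hb <;> rw [hb] <;> simp <;> ring
      · exact fun b x => by simp only [iB b x, update_of_ne htk]
      · intro b
        rw [mul_assoc, ← mul_assoc (xPow (β b)), hx, one_mul, hR.mul, neg_add_cancel, hR.zero]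

end UniformlyControlled

/-! ### Disentangling a block of qubits -/

section Disentangle

variable {Q : Type} [DecidableEq Q]

/-- The `z`-rotation gives `x` and `y` the common phase `w`. What remains is the real vector `(‖x‖,
‖y‖)`, which the `y`-rotation turns onto the first axis. -/
theorem exists_rotation_kill (x y : ℂ) : ∃ θ φ : ℝ,
    (ryMat θ * rzMat φ) true false * x + (ryMat θ * rzMat φ) true true * y = 0 := by
  refine ⟨-Complex.arg (‖x‖ + ‖y‖ * Complex.I), (x.arg - y.arg) / 2, ?_⟩
  set z : ℂ := ‖x‖ + ‖y‖ * Complex.I with hz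
  have hc : ‖z‖ * Real.cos z.arg = ‖x‖ := by rw [Complex.norm_mul_cos_arg]; simp [hz]
  have hs : ‖z‖ * Real.sin z.arg = ‖y‖ := by rw [Complex.norm_mul_sin_arg]; simp [hz]
  have hc' : (‖z‖ : ℂ) * Complex.cos z.arg = ‖x‖ := by exact_mod_cast hc
  have hs' : (‖z‖ : ℂ) * Complex.sin z.arg = ‖y‖ := by exact_mod_cast hs
  set w : ℂ := Complex.exp (((x.arg + y.arg) / 2 : ℝ) * Complex.I)
  have ex : Complex.exp ((-((x.arg - y.arg) / 2) : ℝ) * Complex.I) * x = w * ‖x‖ := by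
    nth_rewrite 2 [← Complex.norm_mul_exp_arg_mul_I x]
    rw [mul_left_comm, ← Complex.exp_add, mul_comm]
    congr 2; push_cast; ring
  have ey : Complex.exp ((((x.arg - y.arg) / 2) : ℝ) * Complex.I) * y = w * ‖y‖ := by
    nth_rewrite 2 [← Complex.norm_mul_exp_arg_mul_I y]
    rw [mul_left_comm, ← Complex.exp_add, mul_comm]
    congr 2; push_cast; ring
  simp only [ryMat, rzMat, Matrix.mul_apply, Fintype.sum_bool, Matrix.of_apply]
  simp only [if_true, if_false, reduceCtorEq, mul_zero, add_zero, zero_add, Bool.false_eq_true]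
  rw [mul_assoc, mul_assoc, ex, ey]
  simp only [Real.sin_neg, Real.cos_neg, Complex.ofReal_neg, Complex.ofReal_cos, Complex.ofReal_sin]
  rw [← hc', ← hs']
  ring

/-- Every state of the qubits in `S` can be mapped to a multiple of the zero basis state. -/
theorem exists_disentangle (S : Finset Q) (ψ : Vec Q)
    (hψ : ∀ b, ψ b ≠ 0 → ∀ q ∉ S, b q = false) :
    ∃ C : Circuit Q, C.cnotCount + 2 + 2 * S.card = 2 * 2 ^ S.card ∧
      ∀ b, C.run ψ b ≠ 0 → ∀ q, b q = false := by
  induction S using Finset.induction_on generalizing ψ with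
  | empty => exact ⟨[], rfl, fun b hb q => hψ b hb q (by simp)⟩
  | insert t S ht ih =>
    obtain ⟨β, hβ, hβC⟩ := exists_uniformlyControlled t S ht
    choose θ φ hθφ using exists_rotation_kill
    -- Bits off `S` are masked to zero so that the angles depend on `S` only; on the support of `ψ`
    -- the mask changes at most bit `t`.
    let m : (Q → Bool) → Q → Bool := fun b q => if q ∈ S then b q else false
    have hm : DependsOn m (S : Set Q) := fun b b' h => funext fun q => by
      by_cases hq : q ∈ S
      · simp [m, hq, h q hq]
      · simp [m, hq]
    have dep : ∀ f : ℂ → ℂ → ℝ, DependsOn (fun b => f (ψ (update (m b) t false))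
        (ψ (update (m b) t true))) (S : Set Q) := fun f b b' h => by simp only [hm h]
    obtain ⟨A, hA, hArun⟩ := hβC ryMat isRotation_ry _ (dep θ)
    -- The angle is negated because `B` is run inverted, before `A`; the two copies of `X ^ β` then
    -- meet and cancel. Each of `A` and `B` costs `2 ^ |S| - 1`.
    obtain ⟨B, hB, hBrun⟩ := hβC rzMat isRotation_rz _ (dep fun x y => -φ x y)
    have hx : ∀ c, xPow c * xPow c = 1 := fun c => by
      rw [xPow_mul, Bool.xor_self, xPow_false]
    have iβ := indep_of_dependsOn hβ (by simpa using ht)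
    have im := indep_of_dependsOn hm (by simpa using ht)
    have iB : Indep (fun b => xPow (β b) * rzMat (φ (ψ (update (m b) t false))
        (ψ (update (m b) t true)))) t := fun b x => by simp only [iβ b x, im b x]
    have hrun : ∀ χ, (B.inv ++ A).run χ = uc t (fun b => ryMat (θ (ψ (update (m b) t false))
        (ψ (update (m b) t true))) * rzMat (φ (ψ (update (m b) t false))
        (ψ (update (m b) t true)))) χ := fun χ => by
      rw [run_append, uc_leftInverse hBrun iB, hArun, uc_uc iB]
      · refine congrArg (fun M => uc t M χ) (funext fun b => ?_)
        rw [mul_assoc, ← mul_assoc (xPow (β b)), hx, one_mul]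
      · intro b
        rw [mul_assoc, ← mul_assoc (xPow (β b)), hx, one_mul, rzMat_mul, neg_add_cancel,
          isRotation_rz.zero]
    obtain ⟨D, hD, hDrun⟩ := ih ((B.inv ++ A).run ψ) (by
      intro b hb q hq
      rw [hrun] at hb
      by_cases hqt : q = t
      · subst hqt
        by_contra hbq
        have hbq : b q = true := by simpa using hbq
        apply hb
        by_cases hout : ∀ r, r ∉ insert q S → b r = false
        · have hmb : ∀ x, update (m b) q x = update b q x := fun x => funext fun r => by
            by_cases hr : r = q
            · subst hr; simp
            · rw [update_of_ne hr, update_of_ne hr]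
              by_cases hrS : r ∈ S
              · simp [m, hrS]
              · simp [m, hrS, hout r (by simp [hr, hrS])]
          have := hθφ (ψ (update b q false)) (ψ (update b q true))
          simp only [uc, hmb, Fintype.sum_bool, hbq]
          rw [add_comm]; exact this
        · push Not at hout
          obtain ⟨r, hr, hbr⟩ := hout
          have h0 : ∀ x, ψ (update b q x) = 0 := fun x => by
            by_contra h
            have := hψ _ h r hr
            rw [update_of_ne (by rintro rfl; simp at hr)] at this
            exact hbr this
          simp [uc, h0]
      · by_contra hbq
        apply hb
        have h0 : ∀ x, ψ (update b t x) = 0 := fun x => by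
          by_contra h
          have := hψ _ h q (by simp [hqt, hq])
          rw [update_of_ne hqt] at this
          exact hbq this
        simp [uc, h0])
    refine ⟨(B.inv ++ A) ++ D, ?_, fun b hb => ?_⟩
    · rw [cnotCount_append, cnotCount_append, cnotCount_inv, Finset.card_insert_of_notMem ht,
        pow_succ]
      omega
    · rw [run_append] at hb
      exact hDrun b hb

end Disentangle

/-! ### Single-qubit matrices for multi-controlled gates -/

section Matrices

/-- The matrix of `Z ^ c`. -/
def zPow (c : Bool) : Matrix Bool Bool ℂ :=
  Matrix.of fun i j => if i = j then (if c && i then -1 else 1) else 0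

/-- The Hadamard matrix. -/
noncomputable def hMat : Matrix Bool Bool ℂ :=
  Matrix.of fun i j => ((√2 : ℝ) : ℂ)⁻¹ * (if i && j then -1 else 1)

/-- A power of the Hadamard matrix. -/
noncomputable def hPow (c : Bool) : Matrix Bool Bool ℂ := if c then hMat else 1

theorem inv_sqrt_two_mul_self : ((√2 : ℝ) : ℂ)⁻¹ * ((√2 : ℝ) : ℂ)⁻¹ = 1 / 2 := by
  rw [← mul_inv, ← Complex.ofReal_mul, Real.mul_self_sqrt (by norm_num)]
  norm_num

theorem hMat_mul_hMat : hMat * hMat = 1 := by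
  ext i j
  have := inv_sqrt_two_mul_self
  cases i <;> cases j <;> simp [hMat, Matrix.mul_apply] <;> linear_combination 2 * this

theorem hMat_mul_zPow (c : Bool) : hMat * zPow c * hMat = xPow c := by
  ext i j
  have := inv_sqrt_two_mul_self
  cases c <;> cases i <;> cases j <;> simp [hMat, zPow, xPow, Matrix.mul_apply] <;>
    linear_combination 2 * this

theorem hMat_mul_xPow (c : Bool) : hMat * xPow c * hMat = zPow c := by
  rw [← hMat_mul_zPow, ← mul_assoc, ← mul_assoc, hMat_mul_hMat, one_mul, mul_assoc, hMat_mul_hMat,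
    mul_one]

/-- The Hadamard gate. -/
noncomputable def hUnitary : Matrix.unitaryGroup Bool ℂ :=
  ⟨hMat, by
    have h : star hMat = hMat := by
      ext i j
      cases i <;> cases j <;> simp [hMat, Matrix.star_apply]
    rw [Matrix.mem_unitaryGroup_iff, h, hMat_mul_hMat]⟩

theorem hUnitary_inv : ((hUnitary⁻¹ : Matrix.unitaryGroup Bool ℂ) : Matrix Bool Bool ℂ) = hMat := by
  have h := unitary_mul_inv hUnitary
  calc _ = hMat * (hMat * ((hUnitary⁻¹ : Matrix.unitaryGroup Bool ℂ) : Matrix Bool Bool ℂ)) := by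
        rw [← mul_assoc, hMat_mul_hMat, one_mul]
    _ = hMat := by
        change hMat * (hUnitary.1 * _) = _
        rw [h, mul_one]

/-- The unitary of a rotation. -/
noncomputable def IsRotation.unitary {R : ℝ → Matrix Bool Bool ℂ} (hR : IsRotation R) (θ : ℝ) :
    Matrix.unitaryGroup Bool ℂ := ⟨R θ, hR.mem θ⟩

theorem IsRotation.unitary_inv {R : ℝ → Matrix Bool Bool ℂ} (hR : IsRotation R) (θ : ℝ) :
    (((hR.unitary θ)⁻¹ : Matrix.unitaryGroup Bool ℂ) : Matrix Bool Bool ℂ) = R (-θ) := by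
  have h : R θ * _ = 1 := unitary_mul_inv (hR.unitary θ)
  calc _ = R (-θ) * (R θ * (((hR.unitary θ)⁻¹ : Matrix.unitaryGroup Bool ℂ) :
          Matrix Bool Bool ℂ)) := by
        rw [← mul_assoc, hR.mul, neg_add_cancel, hR.zero, one_mul]
    _ = R (-θ) := by rw [h, mul_one]

/-- `Z` reverses `y`-rotations, so the conjugate of `Z` is `Ry(π/4) Z`, the Hadamard matrix. A
controlled Hadamard thus costs no more CNOTs than a controlled `Z`. -/
theorem ryMat_mul_zPow (c : Bool) :
    ryMat (Real.pi / 8) * zPow c * ryMat (-(Real.pi / 8)) = hPow c := by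
  cases c
  · have : zPow false = 1 := by ext i j; cases i <;> cases j <;> simp [zPow]
    rw [this, mul_one, ryMat_mul, add_neg_cancel, isRotation_ry.zero]; rfl
  · have h : zPow true * ryMat (-(Real.pi / 8)) = ryMat (Real.pi / 8) * zPow true := by
      ext i j; cases i <;> cases j <;> simp [zPow, ryMat, Matrix.mul_apply]
    have hc : Real.cos (Real.pi / 4) = (√2)⁻¹ := by
      rw [Real.cos_pi_div_four]; field_simp; norm_num
    have hs : Real.sin (Real.pi / 4) = (√2)⁻¹ := by
      rw [Real.sin_pi_div_four]; field_simp; norm_num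
    rw [mul_assoc, h, ← mul_assoc, ryMat_mul, show Real.pi / 8 + Real.pi / 8 = Real.pi / 4 by ring]
    ext i j
    cases i <;> cases j <;>
      simp [zPow, ryMat, Matrix.mul_apply, hPow, hMat, hc, hs, -Complex.ofReal_cos,
        -Complex.ofReal_sin]

theorem hPow_mul_zPow_mul_hPow (c r : Bool) :
    hPow c * zPow r * hPow c = if c then xPow r else zPow r := by
  cases c
  · simp [hPow]
  · simpa [hPow] using hMat_mul_zPow r

end Matrices

/-! ### Multi-controlled gates -/

section MultiControlled

variable {Q : Type}

theorem cnotCount_conj (t : Q) (C : Circuit Q) (U V : Matrix.unitaryGroup Bool ℂ) :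
    Circuit.cnotCount (.single t U :: (C ++ [.single t V])) = C.cnotCount := by
  simp [cnotCount_cons, cnotCount_append, Gate.cnotCost]

/-- All bits of `K` are set. -/
def allOn (K : Finset Q) (b : Q → Bool) : Bool := decide (∀ q ∈ K, b q = true)

theorem allOn_singleton (c : Q) (b : Q → Bool) : allOn {c} b = b c := by
  simp [allOn]

variable [DecidableEq Q]

theorem uc_zPow (t : Q) (p : (Q → Bool) → Bool) (ψ : Vec Q) :
    uc t (fun b => zPow (p b)) ψ = fun b => (if p b && b t then -1 else 1) * ψ b := by
  funext b
  have h := update_eq_self t b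
  cases hb : b t <;> rw [hb] at h <;> simp [uc, zPow, hb, h]

theorem allOn_insert (c : Q) (K : Finset Q) (b : Q → Bool) :
    allOn (insert c K) b = (b c && allOn K b) := by
  simp [allOn, Bool.decide_and]

theorem allOn_union (K L : Finset Q) (b : Q → Bool) :
    allOn (K ∪ L) b = (allOn K b && allOn L b) := by
  rw [allOn, allOn, allOn, ← Bool.decide_and]
  exact decide_eq_decide.2 Finset.forall_mem_union

theorem indep_allOn {K : Finset Q} {t : Q} (ht : t ∉ K) : Indep (allOn K) t :=
  indep_of_dependsOn (S := (K : Set Q))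
    (fun b b' h => by
      unfold allOn
      exact decide_eq_decide.2 (forall₂_congr fun q hq => by rw [h q hq]))
    (by simpa using ht)

theorem run_conj {t : Q} {M : (Q → Bool) → Matrix Bool Bool ℂ} (hM : Indep M t) {C : Circuit Q}
    (hC : ∀ ψ, C.run ψ = uc t M ψ) (U : Matrix.unitaryGroup Bool ℂ) (ψ : Vec Q) :
    Circuit.run (.single t U⁻¹ :: (C ++ [.single t U])) ψ =
      uc t (fun b => (U : Matrix Bool Bool ℂ) * M b *
        ((U⁻¹ : Matrix.unitaryGroup Bool ℂ) : Matrix Bool Bool ℂ)) ψ := by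
  rw [run_cons, run_append, hC, run_cons, run_nil, apply_single, apply_single,
    uc_uc (Indep.const _ _), uc_uc]
  · simp only [mul_assoc]
  · exact fun b x => by simp only [hM b x]

theorem exists_cz (k t : Q) (h : k ≠ t) : ∃ C : Circuit Q, C.cnotCount = 1 ∧
    ∀ ψ, C.run ψ = uc t (fun b => zPow (b k)) ψ := by
  refine ⟨_, cnotCount_conj t [.cnot k t h] hUnitary⁻¹ hUnitary, fun ψ => ?_⟩
  rw [run_conj ((Indep.eval h).comp _) (fun ψ => by rw [run_cons, run_nil, apply_cnot])]
  simp only [hUnitary_inv]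
  exact congrArg (fun M => uc t M ψ) (funext fun b => hMat_mul_xPow _)

theorem exists_hPow_of_zPow {t : Q} {p : (Q → Bool) → Bool} (hp : Indep p t) {C : Circuit Q}
    (hC : ∀ ψ, C.run ψ = uc t (fun b => zPow (p b)) ψ) :
    ∃ C' : Circuit Q, C'.cnotCount = C.cnotCount ∧
      ∀ ψ, C'.run ψ = uc t (fun b => hPow (p b)) ψ := by
  refine ⟨_, cnotCount_conj t C (isRotation_ry.unitary (Real.pi / 8))⁻¹ (isRotation_ry.unitary (Real.pi / 8)), fun ψ => ?_⟩
  rw [run_conj (hp.comp _) hC]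
  simp only [isRotation_ry.unitary_inv]
  exact congrArg (fun M => uc t M ψ) (funext fun b => ryMat_mul_zPow _)

theorem exists_ch (k t : Q) (h : k ≠ t) : ∃ C : Circuit Q, C.cnotCount = 1 ∧
    ∀ ψ, C.run ψ = uc t (fun b => hPow (b k)) ψ := by
  obtain ⟨C, hC, hrun⟩ := exists_cz k t h
  obtain ⟨C', hC', hrun'⟩ := exists_hPow_of_zPow (Indep.eval h) hrun
  exact ⟨C', hC'.trans hC, hrun'⟩

/-- The middle operation flips `a` exactly when `c` and `r` hold and otherwise only adds a sign. The
two controlled `Z` gates see values of `a` differing by `c ∧ r`, so they leave `Z ^ (c ∧ r)` on `t`,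
whatever the state of the dirty qubit `a`. -/
theorem cz_toggle_cz {a t c : Q} {r : (Q → Bool) → Bool} (hat : a ≠ t) (hca : c ≠ a)
    (hra : Indep r a) (ψ : Vec Q) :
    uc t (fun b => zPow (b a)) (uc a (fun b => hPow (b c) * zPow (r b) * hPow (b c))
      (uc t (fun b => zPow (b a)) ψ)) =
    uc a (fun b => hPow (b c) * zPow (r b) * hPow (b c))
      (uc t (fun b => zPow (b c && r b)) ψ) := by
  simp only [hPow_mul_zPow_mul_hPow, uc_zPow]
  funext b
  have h := update_eq_self a b
  cases hc : b c <;> cases hr : r b <;> cases ha : b a <;> rw [ha] at h <;> cases ht : b t <;>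
    simp [uc, hc, hr, ha, ht, xPow, zPow, update_of_ne hat.symm, update_of_ne hca, hra b, h]

/-- A multi-controlled `Z` up to an operation on the dirty qubits `D`, which is the effect of a
second circuit. -/
theorem exists_ladder (K : Finset Q) (hK : K.Nonempty) : ∀ (t : Q) (D : Finset Q), t ∉ K → t ∉ D →
    Disjoint K D → K.card ≤ D.card + 1 → ∃ C W : Circuit Q,
      C.cnotCount + 3 ≤ 4 * K.card ∧ W.cnotCount + 4 ≤ 4 * K.card ∧
      (∀ ψ, C.run ψ = W.run (uc t (fun b => zPow (allOn K b)) ψ)) ∧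
      ∀ (q : Q) (N : (Q → Bool) → Matrix Bool Bool ℂ), q ∉ K → q ∉ D → (∀ d ∈ D, Indep N d) →
        ∀ ψ, W.run (uc q N ψ) = uc q N (W.run ψ) := by
  induction hK using Finset.Nonempty.cons_induction with
  | singleton k =>
    intro t D htK _ _ _
    obtain ⟨C, hC, hrun⟩ := exists_cz k t (fun h => htK (by simp [h]))
    refine ⟨C, [], by simp [hC], by simp, fun ψ => ?_, fun _ _ _ _ _ _ => rfl⟩
    simp only [hrun, run_nil, allOn_singleton]
  | cons c K hcK hK ih =>
    intro t D htK htD hdis hcard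
    rw [Finset.cons_eq_insert] at htK hdis ⊢
    rw [Finset.card_cons] at hcard
    have hcD : c ∉ D := Finset.disjoint_left.1 hdis (by simp)
    have hKD : Disjoint K D := hdis.mono_left (Finset.subset_insert _ _)
    have hct : c ≠ t := fun h => htK (by simp [h])
    have htK' : t ∉ K := fun h => htK (by simp [h])
    obtain ⟨a, ha⟩ : D.Nonempty := by
      rw [← Finset.card_pos]
      have := hK.card_pos
      omega
    have haK : a ∉ K := fun h => Finset.disjoint_left.1 hKD h ha
    have hca : c ≠ a := fun h => hcD (h ▸ ha)
    have hat : a ≠ t := fun h => htD (h ▸ ha)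
    -- The recursion aims the remaining controls at the dirty qubit `a`, which becomes the target
    -- and leaves the pool.
    obtain ⟨C, W, hC, hW, hrun, hcomm⟩ := ih a (D.erase a) haK (by simp)
      (hKD.mono_right (Finset.erase_subset _ _)) (by rw [Finset.card_erase_of_mem ha]; omega)
    obtain ⟨H, hH, hHrun⟩ := exists_ch c a hca
    obtain ⟨Z, hZ, hZrun⟩ := exists_cz a t hat
    have ira : Indep (allOn K) a := indep_allOn haK
    have icz : Indep (fun b : Q → Bool => hPow (b c)) a := (Indep.eval hca).comp _
    have hL : ∀ χ, (H ++ C ++ H).run χ = W.run (uc a (fun b => hPow (b c) * zPow (allOn K b) *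
        hPow (b c)) χ) := fun χ => by
      rw [run_append, run_append, hHrun, hrun, hHrun, ← hcomm a _ haK (by simp), uc_uc icz, uc_uc]
      · simp only [mul_assoc]
      · exact (ira.comp zPow).comp₂ icz (· * ·)
      · exact fun d hd => (Indep.eval (ne_of_mem_of_not_mem (Finset.mem_of_mem_erase hd) hcD).symm).comp _
    -- Two controlled Hadamards and two controlled `Z` gates give four CNOTs per extra control. The
    -- error is the inner circuit itself, without the outer `Z` gates.
    refine ⟨Z ++ (H ++ C ++ H) ++ Z, H ++ C ++ H, ?_, ?_, fun ψ => ?_, ?_⟩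
    · simp only [cnotCount_append, Finset.card_insert_of_notMem hcK, hH, hZ]
      omega
    · simp only [cnotCount_append, Finset.card_insert_of_notMem hcK, hH]
      omega
    · rw [run_append, run_append, hL, hL, hZrun, hZrun, ← hcomm t _ htK'
        (fun h => htD (Finset.mem_of_mem_erase h)), cz_toggle_cz hat hca ira]
      · simp only [allOn_insert]
      · exact fun d hd => (Indep.eval (Finset.ne_of_mem_erase hd).symm).comp _
    · intro q N hqK hqD hN ψ
      have hqc : c ≠ q := fun h => hqK (by simp [h])
      have hqK' : q ∉ K := fun h => hqK (by simp [h])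
      rw [hL, hL, uc_comm (ne_of_mem_of_not_mem ha hqD) _ (hN a ha), hcomm q N hqK'
        (fun h => hqD (Finset.mem_of_mem_erase h)) fun d hd => hN d (Finset.mem_of_mem_erase hd)]
      exact ((((Indep.eval hqc).comp hPow).comp₂ ((indep_allOn hqK').comp zPow) (· * ·)).comp₂
        ((Indep.eval hqc).comp hPow) (· * ·))

/-- The multi-controlled `Z` gate with dirty ancillas. -/
theorem exists_multiControlledZ {K : Finset Q} (hK : K.Nonempty) {t : Q} {D : Finset Q}
    (htK : t ∉ K) (htD : t ∉ D) (hdis : Disjoint K D) (hcard : K.card ≤ D.card + 1) :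
    ∃ C : Circuit Q, C.cnotCount + 7 ≤ 8 * K.card ∧
      ∀ ψ, C.run ψ = uc t (fun b => zPow (allOn K b)) ψ := by
  obtain ⟨C, W, hC, hW, hrun, -⟩ := exists_ladder K hK t D htK htD hdis hcard
  -- Undoing the side effect `W` restores the dirty qubits: `(4k - 3) + (4k - 4) = 8k - 7` for `k`
  -- controls.
  refine ⟨C ++ W.inv, ?_, fun ψ => by rw [run_append, hrun, Circuit.inv_run]⟩
  rw [cnotCount_append, cnotCount_inv]
  omega

/-- Up to a diagonal factor, `C` flips bit `t` under the condition `p`, which does not depend on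
bit `t`. -/
def IsFlip (C : Circuit Q) (t : Q) (p : (Q → Bool) → Bool) : Prop :=
  Indep p t ∧ ∃ δ : (Q → Bool) → ℂ, (∀ b, δ b ≠ 0) ∧
    ∀ ψ b, C.run ψ b = δ b * ψ (update b t (xor (b t) (p b)))

theorem isFlip_cnot (k t : Q) (h : k ≠ t) : IsFlip [.cnot k t h] t (fun b => b k) :=
  ⟨Indep.eval h, fun _ => 1, fun _ => one_ne_zero, fun ψ b => by
    rw [run_cons, run_nil, apply_cnot, uc_xPow, one_mul]⟩

theorem IsFlip.inv {C : Circuit Q} {t : Q} {p : (Q → Bool) → Bool} (h : IsFlip C t p) :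
    IsFlip C.inv t p := by
  obtain ⟨hp, δ, hδ, hrun⟩ := h
  refine ⟨hp, fun b => (δ (update b t (xor (b t) (p b))))⁻¹, fun b => inv_ne_zero (hδ _),
    fun χ => ?_⟩
  set ψ : Vec Q := fun b => (δ (update b t (xor (b t) (p b))))⁻¹ *
    χ (update b t (xor (b t) (p b)))
  have : C.run ψ = χ := funext fun b => by
    rw [hrun]
    simp [ψ, hp b, hδ b]
  intro b
  rw [← this, Circuit.inv_run, this]

/-- Compute and uncompute: `R` modifies bit `a`, `C` reads the modified value, and `R.inv` restores
it. Diagonal factors are only permuted by flips, so the result is again a flip up to a diagonal. -/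
theorem IsFlip.conj {R C : Circuit Q} {a t : Q} {r p : (Q → Bool) → Bool} (hR : IsFlip R a r)
    (hC : IsFlip C t p) (hat : a ≠ t) (hrt : Indep r t) :
    IsFlip (R ++ C ++ R.inv) t (fun b => p (update b a (xor (b a) (r b)))) := by
  obtain ⟨-, δ', hδ', hrun'⟩ := hR.inv
  obtain ⟨hra, δ, hδ, hrun⟩ := hR
  obtain ⟨hp, ε, hε, hCrun⟩ := hC
  refine ⟨fun b x => ?_, fun b => δ' b * (ε (update b a (xor (b a) (r b))) *
    δ (update (update b a (xor (b a) (r b))) t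
      (xor (b t) (p (update b a (xor (b a) (r b))))))),
    fun b => mul_ne_zero (hδ' _) (mul_ne_zero (hε _) (hδ _)), fun ψ b => ?_⟩
  · dsimp only
    rw [hrt, update_of_ne hat, update_comm hat.symm, hp]
  · rw [run_append, run_append, hrun', hCrun, hrun]
    simp only [update_of_ne hat.symm, update_of_ne hat, hrt _, hra _, update_self]
    rw [update_comm hat, update_idem, ← mul_assoc, ← mul_assoc, mul_assoc (δ' b)]
    congr 2
    simp [update_of_ne hat]

/-- Where `β` holds, the Hadamards turn `Z ^ α` into `X ^ α`; elsewhere `Z ^ α` survives and is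
diagonal. The conjunction thus arises without a gate that is controlled by both conditions. -/
theorem isFlip_sandwich {t : Q} {α β : (Q → Bool) → Bool} {z : (Q → Bool) → ℂ}
    (hα : Indep α t) (hβ : Indep β t) (hz : Indep z t) (hz0 : ∀ b, z b ≠ 0) {H C : Circuit Q}
    (hH : ∀ ψ, H.run ψ = uc t (fun b => hPow (β b)) ψ)
    (hC : ∀ ψ, C.run ψ = uc t (fun b => z b • zPow (α b)) ψ) :
    IsFlip (H ++ C ++ H) t (fun b => β b && α b) := by
  refine ⟨hβ.comp₂ hα _, fun b => z b * if !β b && α b && b t then -1 else 1, fun b => ?_,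
    fun ψ b => ?_⟩
  · exact mul_ne_zero (hz0 b) (by split_ifs <;> simp)
  · rw [run_append, run_append, hH, hC, hH, uc_uc (hβ.comp _), uc_uc]
    · have h : ∀ b, hPow (β b) * (z b • zPow (α b) * hPow (β b)) =
          z b • if β b then xPow (α b) else zPow (α b) := fun b => by
        rw [← hPow_mul_zPow_mul_hPow, smul_mul_assoc, mul_smul_comm, mul_assoc]
      have hb := update_eq_self t b
      simp only [h]
      cases hβb : β b <;> cases hαb : α b <;> cases htb : b t <;> rw [htb] at hb <;>
        simp [uc, hβb, hαb, htb, hb, xPow, zPow]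
    · exact fun b x => by simp only [hα b x, hβ b x, hz b x]

/-- The multi-controlled `X` gate without ancillas, up to a diagonal. -/
theorem exists_isFlip_allOn {T : Finset Q} {t : Q} (ht : t ∉ T) (hT : T.Nonempty) :
    ∃ C : Circuit Q, IsFlip C t (allOn T) ∧
      (C.cnotCount = 1 ∧ T.card = 1 ∨ C.cnotCount + 21 ≤ 12 * T.card) := by
  by_cases h1 : T.card = 1
  · obtain ⟨k, rfl⟩ := Finset.card_eq_one.1 h1
    refine ⟨[.cnot k t fun h => ht (by simp [h])], ?_, Or.inl ⟨rfl, h1⟩⟩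
    have := isFlip_cnot k t fun h => ht (by simp [h])
    rwa [show (fun b : Q → Bool => b k) = allOn {k} from
      funext fun b => (allOn_singleton k b).symm] at this
  · have hpos := hT.card_pos
    -- The controls are split in halves, each serving as the dirty ancillas of the other. The
    -- smaller half is `B`, whose circuit is used twice: `2 (8 |B| - 7) + 8 |A| - 7 ≤ 12 |T| - 21`.
    obtain ⟨B, hBT, hB⟩ := Finset.exists_subset_card_eq (Nat.div_le_self T.card 2)
    have hA : (T \ B).card = T.card - T.card / 2 := by rw [Finset.card_sdiff_of_subset hBT, hB]
    have htB : t ∉ B := fun h => ht (hBT h)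
    have htA : t ∉ T \ B := fun h => ht (Finset.sdiff_subset h)
    obtain ⟨CB, hCB, hBrun⟩ := exists_multiControlledZ (K := B) (Finset.card_pos.1 (by omega)) htB
      htA Finset.disjoint_sdiff (by omega)
    obtain ⟨CA, hCA, hArun⟩ := exists_multiControlledZ (K := T \ B) (Finset.card_pos.1 (by omega))
      htA htB Finset.sdiff_disjoint (by omega)
    obtain ⟨H, hH, hHrun⟩ := exists_hPow_of_zPow (indep_allOn htB) hBrun
    refine ⟨H ++ CA ++ H, ?_, Or.inr ?_⟩
    · have := isFlip_sandwich (indep_allOn htA) (indep_allOn htB) (Indep.const 1 t)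
        (fun _ => one_ne_zero) hHrun (C := CA) (by simpa using hArun)
      simpa only [← allOn_union, Finset.union_sdiff_of_subset hBT] using this
    · rw [cnotCount_append, cnotCount_append, hH]
      omega

/-- If at most one of `y`, `z` is set, the repeated word reduces to the identity. If both are, each
half is `Rz(π/4)`, and the square `Rz(π/2)` equals `-i Z`. The phase `-i` depends on the controls
only and is absorbed into the diagonal. -/
theorem rzMat_commutator (y z : Bool) :
    rzMat (Real.pi / 8) * (xPow z * (rzMat (-(Real.pi / 8)) * xPow y)) *
      (rzMat (Real.pi / 8) * (xPow z * (rzMat (-(Real.pi / 8)) * xPow y))) =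
    (if y && z then -Complex.I else 1) • zPow (y && z) := by
  have z1 : zPow false = 1 := by ext i j; cases i <;> cases j <;> simp [zPow]
  have hf := isRotation_rz.flip
  have hxx : xPow true * xPow true = 1 := by rw [xPow_mul]; exact xPow_false
  have hsq : ∀ a, rzMat a * xPow true * (rzMat a * xPow true) = 1 := fun a => by
    rw [mul_assoc, ← mul_assoc (xPow true), hf, mul_assoc, hxx, mul_one, rzMat_mul,
      add_neg_cancel, isRotation_rz.zero]
  cases y <;> cases z
  · simp [xPow_false, z1, rzMat_mul, isRotation_rz.zero]
  · rw [xPow_false, mul_one, hf, neg_neg, ← mul_assoc (rzMat _) (rzMat _), rzMat_mul, hsq]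
    simp [z1]
  · simp [xPow_false, z1, ← mul_assoc, rzMat_mul, isRotation_rz.zero, hxx]
  · have h : rzMat (Real.pi / 8) * (xPow true * (rzMat (-(Real.pi / 8)) * xPow true)) =
        rzMat (Real.pi / 4) := by
      rw [← mul_assoc (xPow true), hf, mul_assoc (rzMat _) (xPow true), hxx, mul_one, rzMat_mul]
      congr 1; ring
    rw [h, rzMat_mul, show Real.pi / 4 + Real.pi / 4 = Real.pi / 2 by ring]
    ext i j
    cases i <;> cases j <;> simp [rzMat, zPow, Complex.exp_neg, Complex.exp_pi_div_two_mul_I]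

/-- The triply controlled `X` gate up to a diagonal. -/
theorem exists_isFlip_three {x y z t : Q} (hx : x ≠ t) (hy : y ≠ t) (hz : z ≠ t) :
    ∃ C : Circuit Q, C.cnotCount = 6 ∧ IsFlip C t (fun b => b x && (b y && b z)) := by
  obtain ⟨H, hH, hHrun⟩ := exists_ch x t hx
  have hX : ∀ k, k ≠ t → Indep (fun b : Q → Bool => xPow (b k)) t := fun k hk =>
    (Indep.eval hk).comp _
  have iyz : Indep (fun b : Q → Bool => b y && b z) t := (Indep.eval hy).comp₂ (Indep.eval hz) _
  obtain ⟨W, hWc, hW⟩ : ∃ W : Circuit Q, W.cnotCount = 2 ∧ ∀ ψ, W.run ψ = uc t (fun b =>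
      rzMat (Real.pi / 8) * (xPow (b z) * (rzMat (-(Real.pi / 8)) * xPow (b y)))) ψ := by
    refine ⟨[.cnot y t hy, .single t (isRotation_rz.unitary (-(Real.pi / 8))), .cnot z t hz,
      .single t (isRotation_rz.unitary (Real.pi / 8))], rfl, fun ψ => ?_⟩
    simp only [run_cons, run_nil, apply_cnot, apply_single]
    rw [uc_uc (hX y hy), uc_uc, uc_uc]
    · simp only [mul_assoc]; rfl
    · exact (hX y hy).comp _
    · exact hX z hz
  refine ⟨H ++ (W ++ W) ++ H, by simp [cnotCount_append, hH, hWc],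
    isFlip_sandwich iyz (Indep.eval hx) (iyz.comp fun c => if c then -Complex.I else 1)
      (fun b => ?_) hHrun fun ψ => ?_⟩
  · split_ifs <;> simp
  · rw [run_append, hW, hW, uc_uc]
    · exact congrArg (fun M => uc t M ψ) (funext fun b => rzMat_commutator _ _)
    · exact (hX z hz).comp₂ (hX y hy) fun A B => rzMat (Real.pi / 8) * (A * (rzMat _ * B))

/-- The multi-controlled `X` gate with clean ancillas, up to a diagonal. -/
theorem exists_isFlip_clean (T : Finset Q) (t : Q) : ∀ A : Finset Q, t ∉ T → t ∉ A → Disjoint T A →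
    2 ≤ T.card → T.card ≤ 2 * A.card + 3 → ∃ (C : Circuit Q) (p : (Q → Bool) → Bool),
      IsFlip C t p ∧ (∀ b, (∀ a ∈ A, b a = false) → p b = allOn T b) ∧
      C.cnotCount + 9 ≤ 6 * T.card := by
  induction hn : T.card using Nat.strong_induction_on generalizing T with
  | _ n ih =>
  subst hn
  intro A htT htA hdis h2 hcard
  obtain h | h | h : T.card = 2 ∨ T.card = 3 ∨ 4 ≤ T.card := by omega
  -- For two controls `12 * 2 - 21 = 3 = 6 * 2 - 9`, so the ancilla-free construction already meets
  -- the bound.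
  · obtain ⟨C, hC, hcost⟩ := exists_isFlip_allOn htT (Finset.card_pos.1 (by omega))
    exact ⟨C, _, hC, fun _ _ => rfl, by omega⟩
  · obtain ⟨x, y, z, hxy, hxz, hyz, rfl⟩ := Finset.card_eq_three.1 h
    simp only [Finset.mem_insert, Finset.mem_singleton, not_or] at htT
    obtain ⟨C, hC, hflip⟩ := exists_isFlip_three (Ne.symm htT.1) (Ne.symm htT.2.1)
      (Ne.symm htT.2.2)
    exact ⟨C, _, hflip, fun b _ => by rw [allOn_insert, allOn_insert, allOn_singleton], by omega⟩
  · obtain ⟨S, hST, hS⟩ := Finset.exists_subset_card_eq (show 3 ≤ T.card by omega)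
    obtain ⟨x, y, z, hxy, hxz, hyz, rfl⟩ := Finset.card_eq_three.1 hS
    obtain ⟨a, ha⟩ : A.Nonempty := Finset.card_pos.1 (by omega)
    have haT : a ∉ T := fun h => Finset.disjoint_left.1 hdis h ha
    have hat : a ≠ t := fun h => htA (h ▸ ha)
    have hx : x ∈ T := hST (by simp)
    have hy : y ∈ T := hST (by simp)
    have hz : z ∈ T := hST (by simp)
    have ne : ∀ {p q : Q}, p ∈ T → q ∉ T → p ≠ q := fun hp hq h => hq (h ▸ hp)
    -- The conjunction of three controls is stored in the clean qubit `a`, which replaces them.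
    -- Computing and uncomputing cost 12 CNOTs and remove two controls, six for each.
    obtain ⟨R, hR, hRflip⟩ := exists_isFlip_three (ne hx haT) (ne hy haT) (ne hz haT)
    set T' := T \ {x, y, z}
    have hT' : T'.card = T.card - 3 := by rw [Finset.card_sdiff_of_subset hST, hS]
    have haT' : a ∉ T' := fun h => haT (Finset.sdiff_subset h)
    have hc : (insert a T').card = T.card - 2 := by
      rw [Finset.card_insert_of_notMem haT', hT']; omega
    obtain ⟨C, p, hC, hp, hcost⟩ := ih _ (by omega) (insert a T') hc (A.erase a)
      (by simp [hat.symm, T', htT]) (fun h => htA (Finset.mem_of_mem_erase h))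
      (by
        rw [Finset.disjoint_insert_left]
        exact ⟨by simp, hdis.mono Finset.sdiff_subset (Finset.erase_subset _ _)⟩)
      (by omega) (by rw [Finset.card_erase_of_mem ha]; omega)
    refine ⟨_, _, hRflip.conj hC hat ?_, fun b hb => ?_, ?_⟩
    · exact (Indep.eval (ne hx htT)).comp₂
        ((Indep.eval (ne hy htT)).comp₂ (Indep.eval (ne hz htT)) _) _
    · rw [hp, allOn_insert, update_self, hb a ha, Bool.false_xor, indep_allOn haT']
      · conv_rhs => rw [← Finset.union_sdiff_of_subset hST, allOn_union]
        rw [allOn_insert, allOn_insert, allOn_singleton]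
      · intro a' ha'
        rw [update_of_ne (Finset.ne_of_mem_erase ha'), hb a' (Finset.mem_of_mem_erase ha')]
    · rw [cnotCount_append, cnotCount_append, cnotCount_inv, hR]
      omega

end MultiControlled

/-! ### Pivoting -/

section Pivot

variable {Q : Type} [DecidableEq Q]

theorem exists_fanout (q : Q) (J : Finset Q) (hq : q ∉ J) : ∃ C : Circuit Q, C.cnotCount = J.card ∧
    ∀ ψ, C.run ψ = fun b => ψ (fun j => xor (b j) (decide (j ∈ J) && b q)) := by
  induction J using Finset.induction_on with
  | empty => exact ⟨[], rfl, fun ψ => by simp⟩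
  | insert k J hk ih =>
    have hqk : q ≠ k := fun h => hq (by simp [h])
    obtain ⟨C, hC, hrun⟩ := ih fun h => hq (by simp [h])
    refine ⟨C ++ [.cnot q k hqk], ?_, fun ψ => ?_⟩
    · rw [cnotCount_append, hC, Finset.card_insert_of_notMem hk]; rfl
    · rw [run_append, hrun, run_cons, run_nil, apply_cnot, uc_xPow]
      funext b
      refine congrArg ψ ?_
      funext j
      by_cases hj : j = k
      · subst hj; simp [hk]
      · simp [hj, update_of_ne hqk]

/-- The support of `ψ` outside of the block of basis states that vanish off `T`. -/
def outside (T : Finset Q) (ψ : Vec Q) : Set (Q → Bool) :=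
  {b | ψ b ≠ 0 ∧ ∃ q, q ∉ T ∧ b q = true}

/-- Pigeonhole: a fully occupied block would have `2 ^ |T|` support elements besides `x`, which lies
outside it. -/
theorem exists_unoccupied [Fintype Q] {T : Finset Q} {ψ : Vec Q} (hnnz : nnz ψ ≤ 2 ^ T.card)
    {x : Q → Bool} (hx : x ∈ outside T ψ) :
    ∃ y : Q → Bool, ψ y = 0 ∧ ∀ q, q ∉ T → y q = false := by
  by_contra! h
  have hcard : 2 ^ T.card ≤ (support ψ \ {x}).ncard := by
    rw [← Finset.card_powerset, ← Set.ncard_coe_finset]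
    refine Set.ncard_le_ncard_of_injOn (fun S q => decide (q ∈ S)) (fun S hS => ?_) ?_
    · have hST : S ⊆ T := by simpa using hS
      have hout : ∀ q, q ∉ T → decide (q ∈ S) = false := fun q hq => by simpa using fun h => hq (hST h)
      refine ⟨fun h0 => ?_, ?_⟩
      · obtain ⟨q, hq, hqS⟩ := h _ h0
        exact hqS (hout q hq)
      · rintro rfl
        obtain ⟨-, q, hq, hqS⟩ := hx
        exact Bool.noConfusion ((hout q hq).symm.trans hqS)
    · intro S _ S' _ hSS
      ext q
      simpa using congrFun hSS q
  have := Set.ncard_sdiff_singleton_lt_of_mem (show x ∈ support ψ from hx.1) (Set.toFinite _)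
  unfold nnz at hnnz
  omega

/-- One more element of the support can be moved into the block. -/
theorem exists_pivot_step [Fintype Q] {N T : Finset Q} (hTN : T ⊆ N) {M m : ℕ}
    (hm : N.card + M ≤ m + 1)
    (hflip : ∀ t ∈ N, t ∉ T → ∃ (C : Circuit Q) (p : (Q → Bool) → Bool), IsFlip C t p ∧
      (∀ b, (∀ q, q ∉ N → b q = false) → p b = allOn T b) ∧ C.cnotCount ≤ M)
    {ψ : Vec Q} (hψ : ∀ b, ψ b ≠ 0 → ∀ q, q ∉ N → b q = false) (hnnz : nnz ψ ≤ 2 ^ T.card)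
    {x : Q → Bool} (hx : x ∈ outside T ψ) :
    ∃ C : Circuit Q, C.cnotCount ≤ m ∧ (∀ b, C.run ψ b ≠ 0 → ∀ q, q ∉ N → b q = false) ∧
      nnz (C.run ψ) ≤ nnz ψ ∧ (outside T (C.run ψ)).ncard < (outside T ψ).ncard := by
  obtain ⟨y, hy0, hyT⟩ := exists_unoccupied hnnz hx
  obtain ⟨hx0, q, hqT, hxq⟩ := id hx
  have hqN : q ∈ N := by
    by_contra h
    rw [hψ x hx0 q h] at hxq
    exact Bool.noConfusion hxq
  obtain ⟨C, p, ⟨hpq, δ, hδ, hCrun⟩, hp, hC⟩ := hflip q hqN hqT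
  -- Since `x q` is set, a fan-out from `q` onto the positions where `x` and `y` differ turns `x`
  -- into `y` with bit `q` added. The controlled flip of `q` then produces `y`.
  set J := (N.erase q).filter fun j => x j ≠ y j with hJ
  have hqJ : q ∉ J := by simp [hJ]
  have hJN : ∀ j, j ∉ N → j ∉ J := fun j hj h => hj (Finset.mem_of_mem_erase (Finset.mem_filter.1 h).1)
  obtain ⟨A, hA, hArun⟩ := exists_fanout q J hqJ
  -- Flipping the zero bits of `y` in `T` before and after makes the gate fire on the pattern `y`
  -- instead of all ones.
  set m' := T.filter fun j => y j = false with hm'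
  obtain ⟨X, hX, hXrun⟩ := exists_flips m'
  have hqm : q ∉ m' := fun h => hqT (Finset.mem_filter.1 h).1
  let F : (Q → Bool) → Q → Bool := fun b j => xor (b j) (decide (j ∈ J) && b q)
  let r : (Q → Bool) → Bool := fun b => p (fun j => xor (b j) (decide (j ∈ m')))
  let σ : (Q → Bool) → Q → Bool := fun b => update b q (xor (b q) (r b))
  have hupd : ∀ (b : Q → Bool) c, (fun j => xor (update b q c j) (decide (j ∈ m'))) =
      update (fun j => xor (b j) (decide (j ∈ m'))) q c := fun b c => funext fun j => by
    by_cases hj : j = q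
    · subst hj; simp [hqm]
    · simp [hj]
  have hr : ∀ b c, r (update b q c) = r b := fun b c => by
    simp only [r, hupd, hpq _ _]
  have hrN : ∀ b : Q → Bool, (∀ j, j ∉ N → b j = false) → ((r b = true) ↔ ∀ j ∈ T, b j = y j) :=
    fun b hb => by
      simp only [r]
      rw [hp]
      · simp only [allOn, decide_eq_true_eq]
        refine forall₂_congr fun j hj => ?_
        cases hyj : y j <;> simp [hm', hj, hyj]
      · intro j hj
        rw [hb j hj]
        have : j ∉ m' := fun h => hj (hTN (Finset.mem_filter.1 h).1)
        simp [this]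
  have hFF : ∀ b, F (F b) = b := fun b => funext fun j => by simp [F, hqJ]
  have hσσ : ∀ b, σ (σ b) = b := fun b => by simp [σ, hr]
  -- Block states have bit `q` unset, so the fan-out fixes them.
  have hF : ∀ b : Q → Bool, b q = false → F b = b := fun b hb => funext fun j => by simp [F, hb]
  have hyN : ∀ j, j ∉ N → y j = false := fun j hj => hyT j fun h => hj (hTN h)
  have hyq : y q = false := hyT q hqT
  have hσx : σ (F x) = y := by
    have hFx : F x = update y q true := funext fun j => by
      by_cases hjq : j = q
      · subst hjq; simp [F, hqJ, hxq]
      · rw [update_of_ne hjq]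
        by_cases hjN : j ∈ N
        · by_cases hxy : x j = y j
          · simp [F, hJ, hxy]
          · have : x j = !y j := Bool.eq_not_of_ne hxy
            simp [F, hJ, hjq, hjN, this, hxq]
        · simp [F, hJN j hjN, hyN j hjN, hψ x hx0 j hjN]
    have hry : r y = true := (hrN y hyN).2 fun _ _ => rfl
    rw [hFx]
    simp only [σ, hr, hry, update_self, update_idem, Bool.xor_self]
    rw [← hyq, update_eq_self]
  have hrun : ∀ b, (A ++ (X ++ C ++ X)).run ψ b =
      δ (fun j => xor (b j) (decide (j ∈ m'))) * ψ (F (σ b)) := fun b => by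
    rw [run_append, run_append, run_append, hXrun, hXrun, hArun]
    dsimp only
    rw [hCrun, ← hupd]
    simp only [Bool.xor_assoc, Bool.xor_self, Bool.xor_false, hqm, decide_false]
    rfl
  have hsupp : ∀ b, (A ++ (X ++ C ++ X)).run ψ b ≠ 0 → ψ (F (σ b)) ≠ 0 := fun b hb h =>
    hb (by rw [hrun, h, mul_zero])
  have hinj : Function.Injective fun b => F (σ b) :=
    (LeftInverse.injective hFF).comp (LeftInverse.injective hσσ)
  have hclean : ∀ b, (A ++ (X ++ C ++ X)).run ψ b ≠ 0 → ∀ j, j ∉ N → b j = false := by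
    intro b hb j hj
    have h := hψ _ (hsupp b hb) j hj
    have hjq : j ≠ q := fun h => hj (h ▸ hqN)
    simpa [F, σ, hJN j hj, hjq] using h
  refine ⟨A ++ (X ++ C ++ X), ?_, hclean, ?_, ?_⟩
  · have h1 : J.card ≤ (N.erase q).card := Finset.card_filter_le _ _
    rw [Finset.card_erase_of_mem hqN] at h1
    have := Finset.card_pos.2 ⟨q, hqN⟩
    simp only [cnotCount_append, hA, hX]
    omega
  · exact Set.ncard_le_ncard_of_injOn _ (fun b hb => hsupp b hb) hinj.injOn
  -- The map `b ↦ F (σ b)` pulls the new outside support injectively back into the old one and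
  -- misses `x`, whose image is the block state `y`.
  · refine lt_of_le_of_lt (Set.ncard_le_ncard_of_injOn (t := outside T ψ \ {x}) _ (fun b hb => ?_)
      hinj.injOn) (Set.ncard_sdiff_singleton_lt_of_mem hx (Set.toFinite _))
    obtain ⟨hb0, j, hjT, hbj⟩ := hb
    refine ⟨⟨hsupp b hb0, ?_⟩, fun hbx => ?_⟩
    -- A block state `z` is moved only if it equals `y`, where `ψ` vanishes; otherwise `b = z` lies
    -- in the block, contrary to the choice of `b`.
    · by_contra! hz
      set z := F (σ b) with hzdef
      have hz' : ∀ j, j ∉ T → z j = false := fun j hj => by simpa using hz j hj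
      have hbz : b = σ z := by
        have : F z = σ b := by rw [hzdef, hFF]
        rw [hF z (hz' q hqT)] at this
        rw [this, hσσ]
      have hrz : r z = false := by
        by_contra h
        have hzy : z = y := funext fun i => by
          by_cases hi : i ∈ T
          · exact (hrN z fun i hi => hz' i fun h => hi (hTN h)).1 (by simpa using h) i hi
          · rw [hz' i hi, hyT i hi]
        exact hsupp b hb0 (by rw [← hzdef, hzy, hy0])
      have : b = z := by rw [hbz]; simp [σ, hrz]
      rw [this, hz' j hjT] at hbj
      exact Bool.noConfusion hbj
    · have hbx : F (σ b) = x := hbx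
      have : b = y := by rw [← hσx, ← hbx, hFF, hσσ]
      rw [this, hyT j hjT] at hbj
      exact Bool.noConfusion hbj

theorem exists_pivot [Fintype Q] {N T : Finset Q} (hTN : T ⊆ N) {M m : ℕ}
    (hm : N.card + M ≤ m + 1)
    (hflip : ∀ t ∈ N, t ∉ T → ∃ (C : Circuit Q) (p : (Q → Bool) → Bool), IsFlip C t p ∧
      (∀ b, (∀ q, q ∉ N → b q = false) → p b = allOn T b) ∧ C.cnotCount ≤ M) (k : ℕ) :
    ∀ ψ : Vec Q, (∀ b, ψ b ≠ 0 → ∀ q, q ∉ N → b q = false) → nnz ψ ≤ 2 ^ T.card →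
    (outside T ψ).ncard ≤ k →
    ∃ C : Circuit Q, C.cnotCount ≤ k * m ∧ ∀ b, C.run ψ b ≠ 0 → ∀ q, q ∉ T → b q = false := by
  induction k with
  | zero =>
    intro ψ _ _ hk
    refine ⟨[], by simp, fun b hb q hq => ?_⟩
    have : outside T ψ = ∅ := (Set.ncard_eq_zero (Set.toFinite _)).1 (by omega)
    by_contra h
    exact Set.eq_empty_iff_forall_notMem.1 this b ⟨hb, q, hq, by simpa using h⟩
  | succ k ih =>
    intro ψ hψ hnnz hk
    obtain hemp | ⟨x, hx⟩ := (outside T ψ).eq_empty_or_nonempty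
    · obtain ⟨C, hC, h⟩ := ih ψ hψ hnnz (by simp [hemp])
      exact ⟨C, hC.trans (Nat.mul_le_mul_right _ (Nat.le_succ _)), h⟩
    · obtain ⟨C, hC, hCψ, hCn, hlt⟩ := exists_pivot_step hTN hm hflip hψ hnnz hx
      obtain ⟨D, hD, h⟩ := ih _ hCψ (hCn.trans hnnz) (by omega)
      refine ⟨C ++ D, ?_, fun b hb => h b (by rwa [run_append] at hb)⟩
      rw [cnotCount_append, Nat.succ_mul]
      omega

/-- Preparation of sparse states from a supply of multi-controlled gates. -/
theorem exists_prepare [Fintype Q] {N T : Finset Q} (hTN : T ⊆ N) {M m : ℕ}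
    (hm : N.card + M ≤ m + 1)
    (hflip : ∀ t ∈ N, t ∉ T → ∃ (C : Circuit Q) (p : (Q → Bool) → Bool), IsFlip C t p ∧
      (∀ b, (∀ q, q ∉ N → b q = false) → p b = allOn T b) ∧ C.cnotCount ≤ M)
    {ψ : Vec Q} (hψ : ∀ b, ψ b ≠ 0 → ∀ q, q ∉ N → b q = false) (hnnz : nnz ψ ≤ 2 ^ T.card)
    (hstate : IsState ψ) :
    ∃ C : Circuit Q, C.cnotCount + 2 + 2 * T.card ≤ (nnz ψ - 1) * m + 2 * 2 ^ T.card ∧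
      C.run (fun b => if ∀ q, b q = false then 1 else 0) = ψ := by
  obtain ⟨x, hx⟩ : ∃ x, ψ x ≠ 0 := by
    by_contra! h
    simp [IsState, h] at hstate
  -- Free flips carry one support element to zero, which lies in the block, saving one pivoting
  -- round.
  obtain ⟨X, hX, hXrun⟩ := exists_flips (Finset.univ.filter fun q => x q = true)
  have hXrun' : X.run ψ = fun b => ψ fun j => xor (b j) (x j) := by
    rw [hXrun]; simp
  have hinj : Function.Injective fun (b : Q → Bool) j => xor (b j) (x j) := fun b b' h => by
    funext j
    simpa using congrFun h j
  have hn : nnz (X.run ψ) ≤ nnz ψ := by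
    rw [hXrun']
    exact Set.ncard_le_ncard_of_injOn _ (fun b hb => hb) hinj.injOn
  have hout : (outside T (X.run ψ)).ncard ≤ nnz ψ - 1 := by
    have h0 : (fun _ => false) ∈ support (X.run ψ) := by
      rw [mem_support, hXrun']
      simpa using hx
    have h1 := Set.ncard_sdiff_singleton_lt_of_mem h0 (Set.toFinite _)
    have h2 : (outside T (X.run ψ)).ncard ≤ (support (X.run ψ) \ {fun _ => false}).ncard := by
      refine Set.ncard_le_ncard (fun b hb => ⟨hb.1, ?_⟩) (Set.toFinite _)
      rintro rfl
      obtain ⟨q, -, h⟩ := hb.2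
      exact Bool.noConfusion h
    unfold nnz at hn ⊢
    omega
  obtain ⟨P, hP, hPrun⟩ := exists_pivot hTN hm hflip _ (X.run ψ) (fun b hb q hq => by
    rw [hXrun'] at hb
    have := hψ _ hb q hq
    rw [hψ x hx q hq] at this
    simpa using this) (hn.trans hnnz) hout
  obtain ⟨D, hD, hDrun⟩ := exists_disentangle T (P.run (X.run ψ)) hPrun
  set C := X ++ P ++ D
  have hC : C.run ψ = D.run (P.run (X.run ψ)) := by rw [run_append, run_append]
  rw [← hC] at hDrun
  have hzero : ∀ b, b ≠ (fun _ => false) → C.run ψ b = 0 := fun b hb => by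
    by_contra h
    exact hb (funext (hDrun b h))
  -- Norm preservation forces the single surviving amplitude to be a phase, which a free gate
  -- supplies before the inverse circuit.
  have hnorm : ‖C.run ψ fun _ => false‖ = 1 := by
    have h := run_norm C ψ
    rw [hstate, Finset.sum_eq_single (fun _ => false) (fun b _ hb => by simp [hzero b hb])
      (by simp)] at h
    exact (pow_eq_one_iff_of_nonneg (norm_nonneg _) two_ne_zero).1 h
  refine ⟨.phase ⟨_, mem_sphere_zero_iff_norm.2 hnorm⟩ :: C.inv, ?_, ?_⟩
  · rw [cnotCount_cons, cnotCount_inv, cnotCount_append, cnotCount_append]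
    simp only [Gate.cnotCost]
    omega
  · have : (Gate.phase ⟨_, mem_sphere_zero_iff_norm.2 hnorm⟩).apply
        (fun b : Q → Bool => if ∀ q, b q = false then 1 else 0) = C.run ψ := funext fun b => by
      by_cases hb : b = fun _ => false
      · subst hb; simp [Gate.apply]
      · have h : ¬ ∀ q, b q = false := fun h => hb (funext h)
        simp [Gate.apply, h, hzero b hb]
    rw [run_cons, this, Circuit.inv_run]

end Pivot

/-! ### Preparation through pivoting -/

section Pivoting

/-- The order of `ℕ∞` is well-founded, so a least cost is attained by a circuit unless it is
infinite, and then the bounds are trivial. -/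
theorem biInf_eq_top_or_exists {ι : Type*} (p : ι → Prop) (f : ι → ℕ∞) :
    (⨅ (i) (_ : p i), f i) = ⊤ ∨ ∃ i, p i ∧ f i = ⨅ (i) (_ : p i), f i := by
  rw [iInf_subtype']
  obtain h | h := isEmpty_or_nonempty {i // p i}
  · exact Or.inl (iInf_of_empty _)
  · obtain ⟨i, hi⟩ := csInf_mem (Set.range_nonempty fun i : {i // p i} => f i)
    exact Or.inr ⟨i, i.2, hi⟩

theorem card_lastQubits {n s : ℕ} (h : s ≤ n) : (lastQubits n s).card = s := by
  have : lastQubits n s = Finset.univ.filter fun j : Fin n => ¬ j.val < n - s := by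
    simp [lastQubits]
  rw [this, Finset.filter_not, Finset.card_sdiff_of_subset (Finset.filter_subset _ _),
    Fin.card_filter_val_lt]
  simp
  omega

/-- Inverting a pivoting circuit reduces state preparation to fewer qubits. -/
theorem exists_prepares_of_pivots {n s d c : ℕ} (hsn : s ≤ n) {v : Vec (Fin n)}
    {P : Circuit (Reg n d c)} (hP : PivotsUpToDiag s P v) :
    ∃ w : Vec (Fin s), IsState w ∧ ∀ D : Circuit (Reg s d c), Prepares D w →
      ∃ C : Circuit (Reg n d c), Prepares C v ∧ C.cnotCount = P.cnotCount + D.cnotCount := by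
  obtain ⟨δ, σ, ⟨i, u, hu, hdis⟩, himp⟩ := hP
  obtain ⟨e⟩ : Nonempty (Fin s ≃ {j // j ∈ lastQubits n s}) := by
    refine ⟨Fintype.equivOfCardEq ?_⟩
    rw [Fintype.card_fin, Fintype.card_coe, card_lastQubits hsn]
  let glue : ({j // j ∈ lastQubits n s} → Bool) → Fin n → Bool := fun y j =>
    if h : j ∈ lastQubits n s then y ⟨j, h⟩ else i ⟨j, h⟩
  -- The phases of `Δ` at the basis states extending `i` are put into the target state; being
  -- unimodular, they keep it normalized.
  refine ⟨fun x => δ (glue (x ∘ e.symm)) * u (x ∘ e.symm), ?_, fun D hD => ?_⟩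
  · unfold IsState
    rw [← hu]
    simp only [norm_mul, Circle.norm_coe, one_mul]
    exact Equiv.sum_comp (Equiv.arrowCongr e (Equiv.refl Bool)) fun y => ‖u y‖ ^ 2
  · let f : Reg s d c ↪ Reg n d c :=
      ⟨Sum.map (fun j => (e j).1) id, Sum.map_injective.2
        ⟨Subtype.val_injective.comp e.injective, injective_id⟩⟩
    let I : Finset (Reg n d c) := Finset.univ.filter fun q =>
      ∃ (j : Fin n) (h : j ∉ lastQubits n s), q = .inl j ∧ i ⟨j, h⟩ = true
    obtain ⟨X, hX, hXrun⟩ := exists_flips I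
    have hIr : ∀ q, (.inr q : Reg n d c) ∉ I := fun q => by simp [I]
    have hIl : ∀ j, j ∈ lastQubits n s → (.inl j : Reg n d c) ∉ I := fun j hj h => by
      obtain ⟨j', h', hjj, -⟩ := (Finset.mem_filter.1 h).2
      obtain rfl : j = j' := by simpa using hjj
      exact h' hj
    have hIi : ∀ (j) (h : j ∉ lastQubits n s), decide ((.inl j : Reg n d c) ∈ I) = i ⟨j, h⟩ :=
      fun j h => by
        rw [Bool.eq_iff_iff, decide_eq_true_iff]
        simp [I, h]
    refine ⟨D.relabel f ++ (X ++ P.inv), fun φ => ?_, ?_⟩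
    · have key : (D.relabel f ++ X).run (withAncillas (zeroVec n) φ) =
          withAncillas (diagGate δ (permGate σ v)) φ := by
        rw [run_append, hXrun]
        funext b
        set b' : Reg n d c → Bool := fun q => xor (b q) (decide (q ∈ I)) with hb'
        -- With the first `n - s` qubits frozen, the input slice is the zero state of the small
        -- register or the zero vector; linearity of the run covers both.
        have hsplit : (fun y => withAncillas (zeroVec n) φ (extend f y b')) =
            (if ∀ j, j ∉ lastQubits n s → b' (.inl j) = false then (1 : ℂ) else 0) •
              withAncillas (zeroVec s) φ := funext fun y => by
          have hr : ∀ q, extend f y b' (.inr q) = y (.inr q) := fun q =>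
            f.injective.extend_apply y b' (.inr q)
          have hl : ∀ j : Fin s, extend f y b' (.inl (e j).1) = y (.inl j) := fun j =>
            f.injective.extend_apply y b' (.inl j)
          have hn : ∀ j, j ∉ lastQubits n s → extend f y b' (.inl j) = b' (.inl j) := fun j hj =>
            extend_apply' _ _ _ (by
              rintro ⟨q | q, hq⟩
              · have : (e q).1 = j := Sum.inl.inj hq
                exact hj (this ▸ (e q).2)
              · exact Sum.inr_ne_inl hq)
          have hz : (∀ j, extend f y b' (.inl j) = false) ↔
              (∀ j, j ∉ lastQubits n s → b' (.inl j) = false) ∧ ∀ j : Fin s, y (.inl j) = false := by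
            refine ⟨fun h => ⟨fun j hj => by rw [← hn j hj, h], fun j => by rw [← hl j, h]⟩,
              fun h j => ?_⟩
            by_cases hj : j ∈ lastQubits n s
            · have := hl (e.symm ⟨j, hj⟩)
              rw [Equiv.apply_symm_apply] at this
              rw [this, h.2]
            · rw [hn j hj, h.1 j hj]
          simp only [withAncillas, zeroVec, hr, hz, Pi.smul_apply, smul_eq_mul, ite_and]
          split_ifs <;> simp
        have hrel := run_relabel f D (withAncillas (zeroVec n) φ) b' (b' ∘ f)
        rw [extend_comp_self, hsplit, run_smul, hD φ] at hrel
        rw [hrel]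
        have hbr : ∀ q, b' (.inr q) = b (.inr q) := fun q => by simp [hb', hIr]
        have hbl : ∀ j, j ∈ lastQubits n s → b' (.inl j) = b (.inl j) := fun j hj => by
          simp [hb', hIl j hj]
        have hbi : (∀ j, j ∉ lastQubits n s → b' (.inl j) = false) ↔
            (fun j : {j // j ∉ lastQubits n s} => b (.inl j.1)) = i := by
          rw [funext_iff, Subtype.forall]
          refine forall₂_congr fun j hj => ?_
          simp only [hb', hIi j hj]
          cases b (.inl j) <;> cases i ⟨j, hj⟩ <;> simp
        have hlast : (fun j : Fin s => (b' ∘ f) (.inl j)) ∘ e.symm =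
            fun j => b (.inl j.1) := funext fun j => by
          change b' (.inl (e (e.symm j)).1) = _
          rw [Equiv.apply_symm_apply, hbl _ j.2]
        have hfr : ∀ q, (b' ∘ f) (.inr q) = b (.inr q) := fun q => hbr q
        have hd := hdis fun j => b (.inl j)
        simp only [withAncillas, Pi.smul_apply, smul_eq_mul, hlast, hfr, diagGate, hd, hbi]
        by_cases hi : (fun j : {j // j ∉ lastQubits n s} => b (.inl j.1)) = i
        · have hglue : glue (fun j => b (.inl j.1)) = fun j => b (.inl j) := funext fun j => by
            by_cases hj : j ∈ lastQubits n s
            · simp [glue, hj]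
            · simp [glue, hj, ← hi]
          simp only [hi, if_true, one_mul, hglue]
        · simp [hi]
      rw [← himp v φ] at key
      rw [← List.append_assoc, run_append, key, Circuit.inv_run]
    · rw [cnotCount_append, cnotCount_append, cnotCount_relabel, cnotCount_inv, hX]
      omega

theorem prepCost_le {n s d c : ℕ} (hsn : s ≤ n) (v : Vec (Fin n)) :
    prepCost d c v ≤ pivotCost s d c v + numSP s d c := by
  obtain h | ⟨P, hP, hPc⟩ := biInf_eq_top_or_exists
    (fun C : Circuit (Reg n d c) => PivotsUpToDiag s C v) fun C => (C.cnotCount : ℕ∞)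
  · rw [pivotCost, h, top_add]; exact le_top
  obtain ⟨w, hw, hwD⟩ := exists_prepares_of_pivots hsn hP
  have hle : prepCost d c w ≤ numSP s d c := le_iSup₂_of_le w hw le_rfl
  refine le_trans ?_ (add_le_add_right hle _)
  obtain h | ⟨D, hD, hDc⟩ := biInf_eq_top_or_exists
    (fun C : Circuit (Reg s d c) => Prepares C w) fun C => (C.cnotCount : ℕ∞)
  · rw [prepCost, prepCost, h, add_top]; exact le_top
  obtain ⟨C, hC, hCc⟩ := hwD D hD
  rw [pivotCost, ← hPc, prepCost, prepCost, ← hDc, ← Nat.cast_add, ← hCc]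
  exact iInf₂_le C hC

theorem numSSP_le {n s d c : ℕ} (hsn : s ≤ n) :
    numSSP n s d c ≤ numPivDiag n s d c + numSP s d c :=
  iSup₂_le fun v hv => (prepCost_le hsn v).trans
    (add_le_add_left (le_iSup₂_of_le (f := fun v _ => pivotCost s d c v) v hv le_rfl) _)

end Pivoting

/-! ### Registers without dirty ancillas -/

section Registers

variable {n c : ℕ}

/-- The system qubits. -/
def systemQubits (n c : ℕ) : Finset (Reg n 0 c) := Finset.univ.map Embedding.inl

theorem notMem_systemQubits {q : Reg n 0 c} :
    q ∉ systemQubits n c ↔ ∃ i : Fin c, q = .inr (.inr i) := by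
  rcases q with j | j | i
  · simp [systemQubits]
  · exact j.elim0
  · simp [systemQubits]

theorem card_systemQubits : (systemQubits n c).card = n := by simp [systemQubits]

/-- A state of no dirty qubits is a scalar, so by linearity it suffices to treat the scalar 1. -/
theorem withAncillas_eq_smul (ψ : Vec (Fin n)) (φ : Vec (Fin 0)) :
    (withAncillas ψ φ : Vec (Reg n 0 c)) = φ default • withAncillas ψ fun _ => 1 := by
  funext b
  simp only [withAncillas, Pi.smul_apply, smul_eq_mul, mul_one]
  rw [Subsingleton.elim (fun i : Fin 0 => b (.inr (.inl i))) default]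
  ring

theorem eq_false_of_withAncillas {ψ : Vec (Fin n)} {φ : Vec (Fin 0)} {b : Reg n 0 c → Bool}
    (h : withAncillas ψ φ b ≠ 0) (q : Reg n 0 c) (hq : q ∉ systemQubits n c) : b q = false := by
  obtain ⟨i, rfl⟩ := notMem_systemQubits.1 hq
  by_contra hb
  exact h (by rw [withAncillas, if_neg fun h => hb (h i), mul_zero])

theorem withAncillas_zeroVec : (withAncillas (zeroVec n) (fun _ => 1) : Vec (Reg n 0 c)) =
    fun b => if ∀ q, b q = false then 1 else 0 := by
  funext b
  simp only [withAncillas, zeroVec, Sum.forall, IsEmpty.forall_iff, true_and, mul_one, ite_and]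
  split_ifs <;> simp

theorem eq_of_inl_eq {b b' : Reg n 0 c → Bool} (h : ∀ j, b (.inl j) = b' (.inl j))
    (hb : ∀ i, b (.inr (.inr i)) = false) (hb' : ∀ i, b' (.inr (.inr i)) = false) : b = b' := by
  funext q
  rcases q with j | j | i
  · exact h j
  · exact j.elim0
  · rw [hb, hb']

theorem nnz_withAncillas_le (v : Vec (Fin n)) :
    nnz (withAncillas v (fun _ => 1) : Vec (Reg n 0 c)) ≤ nnz v := by
  refine Set.ncard_le_ncard_of_injOn (fun b j => b (.inl j)) (fun b hb h0 => hb ?_) ?_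
  · have h0 : v (fun j => b (.inl j)) = 0 := h0
    simp [withAncillas, h0]
  · intro b hb b' hb' h
    exact eq_of_inl_eq (congrFun h)
      (fun i => eq_false_of_withAncillas hb _ (notMem_systemQubits.2 ⟨i, rfl⟩))
      (fun i => eq_false_of_withAncillas hb' _ (notMem_systemQubits.2 ⟨i, rfl⟩))

theorem isState_withAncillas {v : Vec (Fin n)} (hv : IsState v) :
    IsState (withAncillas v (fun _ => 1) : Vec (Reg n 0 c)) := by
  unfold IsState
  rw [← hv]
  symm
  refine Finset.sum_of_injOn (fun x => Sum.elim x fun _ => false) ?_ (by simp) ?_ ?_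
  · intro x _ y _ h
    exact funext fun j => congrFun h (.inl j)
  · intro b _ hb
    by_contra h
    apply hb
    have h : withAncillas v (fun _ => 1) b ≠ 0 := fun h0 => h (by simp [h0])
    refine ⟨fun j => b (.inl j), by simp, eq_of_inl_eq (fun j => rfl) (fun i => rfl) fun i => ?_⟩
    exact eq_false_of_withAncillas h _ (notMem_systemQubits.2 ⟨i, rfl⟩)
  · intro x _
    simp [withAncillas]

/-- Preparation of sparse states from a supply of multi-controlled gates. -/
theorem exists_prepares {s M m : ℕ} (hsn : s ≤ n) (hm : n + M ≤ m + 1)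
    (hflip : ∀ (T : Finset (Reg n 0 c)) (t : Reg n 0 c), T ⊆ systemQubits n c →
      t ∈ systemQubits n c → T.card = s → t ∉ T →
      ∃ (C : Circuit (Reg n 0 c)) (p : (Reg n 0 c → Bool) → Bool), IsFlip C t p ∧
        (∀ b, (∀ q, q ∉ systemQubits n c → b q = false) → p b = allOn T b) ∧ C.cnotCount ≤ M)
    {v : Vec (Fin n)} (hv : IsState v) (hnnz : nnz v ≤ 2 ^ s) :
    ∃ C : Circuit (Reg n 0 c), Prepares C v ∧
      C.cnotCount + 2 + 2 * s ≤ (nnz v - 1) * m + 2 * 2 ^ s := by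
  obtain ⟨T, hT, rfl⟩ := Finset.exists_subset_card_eq (s := systemQubits n c) (n := s)
    (by rwa [card_systemQubits])
  have hle := nnz_withAncillas_le (c := c) v
  obtain ⟨C, hC, hrun⟩ := exists_prepare hT (by rwa [card_systemQubits])
    (fun t ht htT => hflip T t hT ht rfl htT) (fun b hb => eq_false_of_withAncillas hb)
    (hle.trans hnnz) (isState_withAncillas hv)
  refine ⟨C, fun φ => ?_, hC.trans ?_⟩
  · rw [withAncillas_eq_smul, run_smul, withAncillas_zeroVec, hrun, ← withAncillas_eq_smul]
  · gcongr

theorem exists_prepares_noAncilla {s m : ℕ} (hsn : s ≤ n) (hs : 1 ≤ s) (hm : n + 16 * s = m + 12)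
    {v : Vec (Fin n)} (hv : IsState v) (hnnz : nnz v ≤ 2 ^ s) :
    ∃ C : Circuit (Reg n 0 0), Prepares C v ∧
      C.cnotCount + 2 + 2 * s ≤ (nnz v - 1) * m + 2 * 2 ^ s := by
  -- This is the allowance left by `m`. It dominates `12 s - 21` for `s ≥ 2` as well as the single
  -- CNOT for `s = 1`.
  refine exists_prepares (M := 16 * s - 11) hsn (by omega) (fun T t _ _ hT htT => ?_) hv hnnz
  obtain ⟨C, hC, hcost⟩ := exists_isFlip_allOn htT (Finset.card_pos.1 (by omega))
  exact ⟨C, _, hC, fun _ _ => rfl, by omega⟩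

theorem exists_prepares_one (hn : 1 ≤ n) {v : Vec (Fin n)} (hv : IsState v) (hnnz : nnz v ≤ 2) :
    ∃ C : Circuit (Reg n 0 c), Prepares C v ∧ C.cnotCount ≤ (nnz v - 1) * n := by
  obtain ⟨C, hC, hcost⟩ := exists_prepares (c := c) (s := 1) (M := 1) (m := n) hn le_rfl
    (fun T t _ _ hT htT => by
      obtain ⟨C, hC, hcost⟩ := exists_isFlip_allOn htT (Finset.card_pos.1 (by omega))
      exact ⟨C, _, hC, fun _ _ => rfl, by omega⟩) hv (by simpa using hnnz)
  exact ⟨C, hC, by omega⟩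

theorem exists_prepares_clean {s m : ℕ} (hsn : s ≤ n) (hs : 2 ≤ s) (hc : s ≤ 2 * c + 3)
    (hm : n + 6 * s = m + 10) {v : Vec (Fin n)} (hv : IsState v) (hnnz : nnz v ≤ 2 ^ s) :
    ∃ C : Circuit (Reg n 0 c), Prepares C v ∧
      C.cnotCount + 2 + 2 * s ≤ (nnz v - 1) * m + 2 * 2 ^ s := by
  refine exists_prepares (M := 6 * s - 9) hsn (by omega) (fun T t hTs ht hT htT => ?_) hv hnnz
  let A : Finset (Reg n 0 c) := Finset.univ.map (Embedding.inr.trans Embedding.inr)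
  have hA : ∀ q, q ∈ A → q ∉ systemQubits n c := fun q hq => by
    obtain ⟨i, -, rfl⟩ := Finset.mem_map.1 hq
    exact notMem_systemQubits.2 ⟨i, rfl⟩
  obtain ⟨C, p, hC, hp, hcost⟩ := exists_isFlip_clean T t A htT (fun h => hA t h ht)
    (Finset.disjoint_left.2 fun q hq h => hA q h (hTs hq)) (by omega) (by simp [A]; omega)
  exact ⟨C, p, hC, fun b hb => hp b fun a ha => hb a (hA a ha), by omega⟩

theorem exists_prepares_basis {v : Vec (Fin n)} (hv : IsState v) (hnnz : nnz v = 1) :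
    ∃ C : Circuit (Reg n 0 c), Prepares C v ∧ C.cnotCount = 0 := by
  -- With no controls the flip is an unconditional `X`, hence free, and `nnz v - 1 = 0` rounds are
  -- charged.
  obtain ⟨C, hC, hcost⟩ := exists_prepares (c := c) (s := 0) (M := 0) (m := n) (Nat.zero_le _)
    (by omega) (fun T t _ _ hT htT => by
      obtain ⟨C, hC, hrun⟩ := exists_flips ({t} : Finset (Reg n 0 c))
      obtain rfl := Finset.card_eq_zero.1 hT
      refine ⟨C, fun _ => true, ⟨Indep.const _ _, fun _ => 1, fun _ => one_ne_zero,
        fun ψ b => ?_⟩, fun b _ => by simp [allOn], hC.le⟩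
      rw [hrun, one_mul]
      refine congrArg ψ (funext fun j => ?_)
      by_cases hj : j = t
      · subst hj; simp
      · simp [hj]) hv (by simp [hnnz])
  refine ⟨C, hC, ?_⟩
  rw [hnnz] at hcost
  simp at hcost
  omega

end Registers

end QCirc

theorem mainTheorem1 (n : ℕ) (v : QCirc.Vec (Fin n)) (hv : QCirc.IsState v)
    (s : ℕ) (hs : s = ⌈Real.logb 2 (QCirc.nnz v : ℝ)⌉₊) :
    (∀ d c : ℕ,
      QCirc.prepCost d c v ≤ QCirc.numSSP n s d c ∧
      QCirc.numSSP n s d c ≤ QCirc.numPivDiag n s d c + QCirc.numSP s d c) ∧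
    (QCirc.nnz v = 1 →
      ∃ C : QCirc.Circuit (QCirc.Reg n 0 0), QCirc.Prepares C v ∧ C.cnotCount = 0) ∧
    (2 ≤ QCirc.nnz v →
      (∃ C : QCirc.Circuit (QCirc.Reg n 0 0), QCirc.Prepares C v ∧
        (C.cnotCount : ℝ) ≤
          ((n : ℝ) + 16 * (s : ℝ) - 9) * (QCirc.nnz v : ℝ) + 23 / 24 * (2 : ℝ) ^ s) ∧
      (∃ C : QCirc.Circuit (QCirc.Reg n 0 ⌈(s : ℝ) / 2 - 1⌉₊), QCirc.Prepares C v ∧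
        (C.cnotCount : ℝ) ≤
          ((n : ℝ) + 6 * (s : ℝ) - 7) * (QCirc.nnz v : ℝ) + 23 / 24 * (2 : ℝ) ^ s)) := by
  have hpos : 0 < QCirc.nnz v := by
    rw [QCirc.nnz, Set.ncard_pos (Set.toFinite _), Function.support_nonempty_iff]
    rintro rfl
    simp [QCirc.IsState] at hv
  have hposR : (0 : ℝ) < QCirc.nnz v := by exact_mod_cast hpos
  have hle : QCirc.nnz v ≤ 2 ^ s := by
    have h := Nat.le_ceil (Real.logb 2 (QCirc.nnz v : ℝ))
    rw [← hs, Real.logb_le_iff_le_rpow (by norm_num) hposR, Real.rpow_natCast] at h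
    exact_mod_cast h
  have hn : QCirc.nnz v ≤ 2 ^ n := by
    have := Set.ncard_le_card (Function.support v)
    simpa [QCirc.nnz] using this
  have hsn : s ≤ n := by
    rw [hs, Nat.ceil_le, Real.logb_le_iff_le_rpow (by norm_num) hposR, Real.rpow_natCast]
    exact_mod_cast hn
  refine ⟨fun d c => ⟨le_iSup₂_of_le (f := fun v _ => QCirc.prepCost d c v) v ⟨hv, hle⟩ le_rfl,
    QCirc.numSSP_le hsn⟩, QCirc.exists_prepares_basis hv, fun h2 => ?_⟩
  have hs1 : 1 ≤ s := by
    by_contra h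
    obtain rfl : s = 0 := by omega
    simp at hle
    omega
  have hlt : (2 : ℝ) ^ s < 2 * QCirc.nnz v := by
    have h0 : 0 ≤ Real.logb 2 (QCirc.nnz v : ℝ) :=
      Real.logb_nonneg (by norm_num) (by exact_mod_cast hpos)
    have h := Nat.ceil_lt_add_one h0
    rw [← hs] at h
    have h' : ((s : ℝ) - 1) < Real.logb 2 (QCirc.nnz v : ℝ) := by linarith
    rw [Real.lt_logb_iff_rpow_lt (by norm_num) hposR, Real.rpow_sub (by norm_num),
      Real.rpow_natCast, Real.rpow_one] at h'
    linarith
  have hsR : (1 : ℝ) ≤ s := by exact_mod_cast hs1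
  have hnR : (1 : ℝ) ≤ n := by exact_mod_cast hs1.trans hsn
  -- After rearrangement the claim is `25/24 * 2 ^ s ≤ 3 * nnz v + (x - 1 + 2 s)`, which follows
  -- from `2 ^ s < 2 * nnz v`. The 3 is the saving per round.
  have hbound : ∀ (k m : ℕ) (x : ℝ), k + 2 + 2 * s ≤ (QCirc.nnz v - 1) * m + 2 * 2 ^ s →
      (m : ℝ) = x - 3 → 0 ≤ x - 1 + 2 * s →
      (k : ℝ) ≤ x * (QCirc.nnz v : ℝ) + 23 / 24 * (2 : ℝ) ^ s := by
    intro k m x hk hm hx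
    have hk' : (k : ℝ) + 2 + 2 * s ≤ ((QCirc.nnz v : ℝ) - 1) * m + 2 * 2 ^ s := by
      have : ((QCirc.nnz v - 1 : ℕ) : ℝ) = (QCirc.nnz v : ℝ) - 1 := by
        rw [Nat.cast_sub hpos, Nat.cast_one]
      rw [← this]
      exact_mod_cast hk
    rw [hm] at hk'
    linarith
  refine ⟨?_, ?_⟩
  · obtain ⟨C, hC, hcost⟩ := QCirc.exists_prepares_noAncilla (m := n + 16 * s - 12) hsn hs1
      (by omega) hv hle
    refine ⟨C, hC, hbound _ _ _ hcost ?_ (by linarith)⟩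
    rw [Nat.cast_sub (by omega)]
    push_cast
    ring
  -- For `s = 1` the allowance `6 s - 9` would be negative. Here `nnz v = 2`, and one round with a
  -- single CNOT as controlled flip costs at most `n`.
  · obtain rfl | hs2 := hs1.eq_or_lt
    · obtain ⟨C, hC, hcost⟩ := QCirc.exists_prepares_one (c := ⌈((1 : ℕ) : ℝ) / 2 - 1⌉₊)
        hsn hv (by simpa using hle)
      have hN : QCirc.nnz v = 2 := by
        simp at hle
        omega
      refine ⟨C, hC, ?_⟩
      rw [hN] at hcost ⊢
      have : (C.cnotCount : ℝ) ≤ n := by exact_mod_cast (by omega : C.cnotCount ≤ n)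
      push_cast
      linarith
    -- The ceiling even gives `s ≤ 2 c + 2`, one better than the recursion requires.
    · have hc : s ≤ 2 * ⌈(s : ℝ) / 2 - 1⌉₊ + 3 := by
        have h := Nat.le_ceil ((s : ℝ) / 2 - 1)
        have : (s : ℝ) ≤ 2 * ⌈(s : ℝ) / 2 - 1⌉₊ + 3 := by linarith
        exact_mod_cast this
      have hs2R : (2 : ℝ) ≤ s := by exact_mod_cast hs2
      obtain ⟨C, hC, hcost⟩ := QCirc.exists_prepares_clean (m := n + 6 * s - 10) hsn hs2 hc
        (by omega) hv hle
      refine ⟨C, hC, hbound _ _ _ hcost ?_ (by linarith)⟩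
      rw [Nat.cast_sub (by omega)]
      push_cast
      ring
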